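/- Let $\mu\in\{0,\tfrac12,1,\tfrac32,\ldots\}$ and let $K_\mu$ be the Macdonald function (modified Bessel function of the second kind, principal branch) on the slit plane $\mathbb{C}\setminus\mathbb{R}_{\le 0}$. Define, for $r>0$, $$M_\mu(r):=\begin{cases} r^{-1/2} & r\ge 1,\\ r^{-\mu} & 0<r\le 1,\ \mu\ge\tfrac12,\\ 1+|\ln r| & 0<r\le 1,\ \mu=0,\end{cases}\qquad N_\mu(r):=\begin{cases} r^{-1/2} & r\ge 1,\\ r^{-\mu} & 0<r\le 1.\end{cases}$$ (a) For all $z\in\mathbb{C}\setminus\mathbb{R}_{\le0}$, $$\left|e^{z}K_\mu(z)\right|\le\sqrt{\frac{\pi}{2|z|}}\,\exp\!\left(\frac{|\mu^2-\frac14|}{|z|}\right).$$ (b) With $C_\mu:=\sqrt{8\pi^3}\,(\mu+1)^2$, for all $z\in\mathbb{C}\setminus\mathbb{R}_{\le0}$, $$\left|e^{z}\bigl(K_\mu(z)-K_{\mu+1}(z)\bigr)\right|\le\frac{C_\mu}{|z|^{3/2}}\exp\!\left(\frac{C_\mu}{|z|}\right).$$ (c) For every $R>0$ there is a constant $C_\mu(R)>0$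 depending only on $\mu$ and $R$ such that for all $z\in\mathbb{C}\setminus\mathbb{R}_{\le0}$ with $|z|\le R$, $$\left|e^{z}K_\mu(z)\right|\le C_\mu(R)\times\begin{cases}1+\bigl|\ln|z|\bigr| & \mu=0,\\ (|z|/2)^{-\mu} & \text{otherwise.}\end{cases}$$ (d) There are constants $C,C'>0$ depending only on $\mu$ such that for all $z\in\mathbb{C}\setminus\mathbb{R}_{\le0}$, $$\left|e^{z}K_\mu(z)\right|\le C\,M_\mu(|z|)\qquad\text{and}\qquad\left|e^{z}\bigl(K_\mu(z)-K_{\mu+1}(z)\bigr)\right|\le C'\,\frac{N_\mu(|z|)}{|z|}.$$ (e) $M_\mu$ is strictly decreasing on $\mathbb{R}_{>0}$. $N_\mu$ is non-increasing on $\mathbb{R}_{>0}$, strictly decreasing on $[1,\infty)$, and, if $\mu\neq0$, strictly decreasing on $\mathbb{R}_{>0}$. Moreover $N_\mu(r)\le M_\mu(r)$ for all $r>0$. -/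

import Mathlib

open MeasureTheory Set Filter Topology

/-- The integrand `e^{-t} t^b (1 + t/(2z))^c`, with principal powers. -/
noncomputable def macdonaldIntegrand (b c : ℝ) (z : ℂ) (t : ℝ) : ℂ :=
  ((Real.exp (-t) * t ^ b : ℝ) : ℂ) * (1 + (t : ℂ) / (2 * z)) ^ (c : ℂ)

/-- The Macdonald function (modified Bessel function of the second kind) `K_μ` of real order
`μ > -1/2` on the slit plane `ℂ ∖ ℝ_{≤ 0}` (principal branch), by the classical formula
`K_μ(z) = √(π/2) / Γ(μ+1/2) * e^{-z} z^{-1/2} ∫_0^∞ e^{-t} t^{μ-1/2} (1 + t/(2z))^{μ-1/2} dt`.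

The theorems `macdonaldK_differentiableOn`, `macdonaldK_bessel_equation` and
`macdonaldK_tendsto` below show that this is the function usually called `K_μ`: it is
holomorphic on the slit plane, it solves the modified Bessel equation
`z² w'' + z w' - (z² + μ²) w = 0` there, and `K_μ(x) ∼ √(π/(2x)) e^{-x}` as `x → ∞`; these
properties single out the standard recessive solution. -/
noncomputable def macdonaldK (μ : ℝ) (z : ℂ) : ℂ :=
  ((Real.sqrt (Real.pi / 2) / Real.Gamma (μ + 1 / 2) : ℝ) : ℂ) * Complex.exp (-z)
    * z ^ (-(1 / 2) : ℂ) * ∫ t in Ioi (0 : ℝ), macdonaldIntegrand (μ - 1 / 2) (μ - 1 / 2) z t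

/-- The majorant `M_μ : ℝ_{>0} → ℝ_{>0}`; the two branches agree at `r = 1`. -/
noncomputable def majorantM (μ r : ℝ) : ℝ :=
  if 1 ≤ r then r ^ (-(1 / 2) : ℝ)
  else if μ = 0 then 1 + |Real.log r|
  else r ^ (-μ)

/-- The majorant `N_μ : ℝ_{>0} → ℝ_{>0}`; the two branches agree at `r = 1`. -/
noncomputable def majorantN (μ r : ℝ) : ℝ :=
  if 1 ≤ r then r ^ (-(1 / 2) : ℝ) else r ^ (-μ)

section MacdonaldFacts

theorem macdonald_m_le {z : ℂ} {t : ℝ} (ht : 0 ≤ t) :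
    max z.re |z.im| ≤ ‖2 * z + t‖ := by
  have h1 := Complex.abs_re_le_norm (2 * z + t)
  have h2 := Complex.abs_im_le_norm (2 * z + t)
  simp at h1 h2
  apply max_le
  · by_cases h : 0 ≤ z.re
    · have := le_abs_self (2 * z.re + t)
      linarith
    · have := norm_nonneg (2 * z + t)
      linarith
  · have := abs_nonneg z.im
    linarith

theorem macdonald_m_pos {z : ℂ} (hz : z ∈ Complex.slitPlane) : 0 < max z.re |z.im| := by
  rcases Complex.mem_slitPlane_iff.1 hz with h | h
  · exact lt_max_of_lt_left h
  · exact lt_max_of_lt_right (abs_pos.2 h)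

theorem macdonald_base_mem {z : ℂ} (hz : z ∈ Complex.slitPlane) {t : ℝ} (ht : 0 ≤ t) :
    1 + (t : ℂ) / (2 * z) ∈ Complex.slitPlane := by
  have hz0 := Complex.slitPlane_ne_zero hz
  have hn : 0 < Complex.normSq z := Complex.normSq_pos.2 hz0
  have hre : (1 + (t : ℂ) / (2 * z)).re = 1 + t / 2 * (z.re / Complex.normSq z) := by
    rw [show (t : ℂ) / (2 * z) = ((t / 2 : ℝ) : ℂ) * z⁻¹ by push_cast; field_simp]
    rw [Complex.add_re, Complex.re_ofReal_mul, Complex.inv_re]; simp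
  have him : (1 + (t : ℂ) / (2 * z)).im = t / 2 * (-z.im / Complex.normSq z) := by
    rw [show (t : ℂ) / (2 * z) = ((t / 2 : ℝ) : ℂ) * z⁻¹ by push_cast; field_simp]
    rw [Complex.add_im, Complex.im_ofReal_mul, Complex.inv_im]; simp
  rw [Complex.mem_slitPlane_iff, hre, him]
  rcases Complex.mem_slitPlane_iff.1 hz with h | h
  · left; positivity
  · rcases ht.eq_or_lt with rfl | ht
    · left; norm_num
    · right
      exact mul_ne_zero (by positivity) (div_ne_zero (neg_ne_zero.2 h) hn.ne')

theorem macdonald_rpow_bound (C δ c : ℝ) (hC : 0 ≤ C) (hδ : 0 < δ) :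
    ∃ K, 0 ≤ K ∧ ∀ t, 0 ≤ t → ∀ s : ℝ, δ ≤ s → s ≤ 1 + C * t → s ^ c ≤ K * Real.exp (t / 2) := by
  rcases le_total 0 c with hc | hc
  · set L := 1 + 2 * (c + 1) * C with hL
    have hL1 : 1 ≤ L := by have : 0 ≤ 2 * (c + 1) * C := by positivity
                           linarith
    refine ⟨L ^ c, by positivity, fun t ht s hs1 hs2 => ?_⟩
    have hs : s ≤ L * Real.exp (t / (2 * (c + 1))) := by
      have h0 := Real.add_one_le_exp (t / (2 * (c + 1)))
      have h1 : C * t = 2 * (c + 1) * C * (t / (2 * (c + 1))) := by field_simp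
      have h2 : 0 ≤ t / (2 * (c + 1)) := by positivity
      have h3 : 0 ≤ 2 * (c + 1) * C := by positivity
      nlinarith
    calc s ^ c ≤ (L * Real.exp (t / (2 * (c + 1)))) ^ c :=
          Real.rpow_le_rpow (hδ.le.trans hs1) hs hc
      _ = L ^ c * Real.exp (t / (2 * (c + 1)) * c) := by
          rw [Real.mul_rpow (by positivity) (by positivity), Real.exp_mul]
      _ ≤ L ^ c * Real.exp (t / 2) := by
          gcongr
          rw [div_mul_eq_mul_div, div_le_div_iff₀ (by positivity) (by norm_num)]
          nlinarith
  · refine ⟨δ ^ c, by positivity, fun t ht s hs1 _ => ?_⟩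
    calc s ^ c ≤ δ ^ c := Real.rpow_le_rpow_of_nonpos hδ hs1 hc
      _ ≤ δ ^ c * Real.exp (t / 2) :=
          le_mul_of_one_le_right (by positivity) (Real.one_le_exp (by positivity))

theorem macdonald_norm_cpow (c : ℝ) {s : ℂ} (hs : s ≠ 0) : ‖s ^ (c : ℂ)‖ = ‖s‖ ^ c := by
  rw [Complex.norm_cpow_of_ne_zero hs]; simp

theorem macdonald_loc_bound (c : ℝ) {z₀ : ℂ} (h₀ : z₀ ∈ Complex.slitPlane) :
    ∃ K, 0 ≤ K ∧ ∃ δ, 0 < δ ∧ ∀ᶠ z in 𝓝 z₀, z ∈ Complex.slitPlane ∧ δ ≤ ‖z‖ ∧ ∀ t : ℝ, 0 ≤ t →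
      ‖(1 + (t : ℂ) / (2 * z)) ^ (c : ℂ)‖ ≤ K * Real.exp (t / 2) := by
  set m := max z₀.re |z₀.im| with hm
  have hm0 : 0 < m := macdonald_m_pos h₀
  have e1 : ∀ᶠ z in 𝓝 z₀, z ∈ Complex.slitPlane := Complex.isOpen_slitPlane.mem_nhds h₀
  have e2 : ∀ᶠ z in 𝓝 z₀, m / 2 < max z.re |z.im| := by
    have : Continuous fun z : ℂ => max z.re |z.im| := by fun_prop
    exact this.continuousAt.eventually (lt_mem_nhds (by change m / 2 < m; linarith))
  have e3 : ∀ᶠ z in 𝓝 z₀, ‖z‖ < ‖z₀‖ + 1 :=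
    continuous_norm.continuousAt.eventually (gt_mem_nhds (by linarith))
  have hδ : 0 < m / 2 / (2 * (‖z₀‖ + 1)) := by positivity
  obtain ⟨K, hK, H⟩ := macdonald_rpow_bound (1 / m) _ c (by positivity) hδ
  refine ⟨K, hK, m / 2, by positivity, ?_⟩
  filter_upwards [e1, e2, e3] with z hz h2 h3
  have hzm : m / 2 ≤ ‖z‖ := by
    refine h2.le.trans (max_le ?_ (Complex.abs_im_le_norm z))
    exact (le_abs_self _).trans (Complex.abs_re_le_norm z)
  have hz0 := Complex.slitPlane_ne_zero hz
  have hzp : 0 < ‖z‖ := norm_pos_iff.2 hz0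
  refine ⟨hz, hzm, fun t ht => ?_⟩
  rw [macdonald_norm_cpow _ (Complex.slitPlane_ne_zero (macdonald_base_mem hz ht))]
  apply H t ht
  · have : 1 + (t : ℂ) / (2 * z) = (2 * z + t) / (2 * z) := by field_simp
    rw [this, norm_div]
    have h4 := macdonald_m_le (z := z) ht
    have h5 : ‖2 * z‖ = 2 * ‖z‖ := by simp
    rw [h5]
    gcongr
    exact h2.le.trans h4
  · refine (norm_add_le _ _).trans ?_
    have h5 : ‖(t : ℂ) / (2 * z)‖ = t / (2 * ‖z‖) := by simp [abs_of_nonneg ht]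
    rw [h5, norm_one]
    have : t / (2 * ‖z‖) ≤ t / m := by gcongr; linarith
    rw [one_div_mul_eq_div]
    linarith

theorem macdonald_bound_integrable {b : ℝ} (hb : -1 < b) (K : ℝ) :
    IntegrableOn (fun t : ℝ => K * (t ^ b * Real.exp (-(1 / 2) * t))) (Ioi 0) := by
  have := integrableOn_rpow_mul_exp_neg_mul_rpow hb one_pos (b := 1 / 2) (by norm_num)
  simp only [Real.rpow_one] at this
  exact this.const_mul K

theorem macdonald_norm_le {b c K : ℝ} {z : ℂ} {t : ℝ} (ht : 0 < t)
    (h : ‖(1 + (t : ℂ) / (2 * z)) ^ (c : ℂ)‖ ≤ K * Real.exp (t / 2)) :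
    ‖macdonaldIntegrand b c z t‖ ≤ K * (t ^ b * Real.exp (-(1 / 2) * t)) := by
  rw [macdonaldIntegrand, norm_mul, Complex.norm_real, Real.norm_of_nonneg (by positivity)]
  calc Real.exp (-t) * t ^ b * _ ≤ Real.exp (-t) * t ^ b * (K * Real.exp (t / 2)) := by gcongr
    _ = K * (t ^ b * (Real.exp (-t) * Real.exp (t / 2))) := by ring
    _ = _ := by rw [← Real.exp_add]; ring_nf

theorem macdonald_aesm (b c : ℝ) {z : ℂ} (hz : z ∈ Complex.slitPlane) :
    AEStronglyMeasurable (macdonaldIntegrand b c z) (volume.restrict (Ioi 0)) := by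
  apply ContinuousOn.aestronglyMeasurable _ measurableSet_Ioi
  intro t ht
  have ht' : (0 : ℝ) < t := ht
  apply ContinuousAt.continuousWithinAt
  unfold macdonaldIntegrand
  refine ContinuousAt.mul ?_ ?_
  · refine Complex.continuous_ofReal.continuousAt.comp ?_
    exact (by fun_prop : ContinuousAt (fun t : ℝ => Real.exp (-t)) t).mul
      (Real.continuousAt_rpow_const _ _ (Or.inl ht'.ne'))
  · exact ContinuousAt.cpow (by fun_prop) continuousAt_const (macdonald_base_mem hz ht'.le)

theorem macdonald_integrable {b : ℝ} (hb : -1 < b) (c : ℝ) {z : ℂ}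
    (hz : z ∈ Complex.slitPlane) :
    IntegrableOn (macdonaldIntegrand b c z) (Ioi 0) := by
  obtain ⟨K, hK, δ, hδ, H⟩ := macdonald_loc_bound c hz
  refine Integrable.mono' (macdonald_bound_integrable hb K) (macdonald_aesm b c hz) ?_
  filter_upwards [ae_restrict_mem measurableSet_Ioi] with t ht
  exact macdonald_norm_le ht (H.self_of_nhds.2.2 t (le_of_lt ht))

theorem macdonald_rpow_succ (b : ℝ) {t : ℝ} (ht : 0 < t) : t ^ (b + 1) = t ^ b * t := by
  rw [Real.rpow_add ht, Real.rpow_one]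

theorem macdonald_cpow_pred (c : ℝ) {s : ℂ} (hs : s ≠ 0) :
    s ^ (c : ℂ) = s ^ ((c - 1 : ℝ) : ℂ) * s := by
  rw [Complex.ofReal_sub, Complex.ofReal_one, Complex.cpow_sub _ _ hs, Complex.cpow_one,
    div_mul_cancel₀ _ hs]

/-- Raising of the exponent. -/
theorem macdonald_integral_split {b : ℝ} (hb : -1 < b) (c : ℝ) {z : ℂ}
    (hz : z ∈ Complex.slitPlane) :
    (∫ t in Ioi (0 : ℝ), macdonaldIntegrand b c z t) =
      (∫ t in Ioi (0 : ℝ), macdonaldIntegrand b (c - 1) z t) +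
      1 / (2 * z) * ∫ t in Ioi (0 : ℝ), macdonaldIntegrand (b + 1) (c - 1) z t := by
  have hz0 := Complex.slitPlane_ne_zero hz
  rw [← integral_const_mul, ← integral_add (macdonald_integrable hb _ hz)
    ((macdonald_integrable (by linarith) _ hz).const_mul _)]
  refine setIntegral_congr_fun measurableSet_Ioi fun t ht => ?_
  have ht' : (0 : ℝ) < t := ht
  simp only [macdonaldIntegrand]
  rw [macdonald_cpow_pred c (Complex.slitPlane_ne_zero (macdonald_base_mem hz ht'.le)),
    macdonald_rpow_succ b ht']
  push_cast
  field_simp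

/-- Differentiation under the integral sign. -/
theorem macdonald_integral_hasDerivAt {b : ℝ} (hb : -1 < b) (c : ℝ) {z : ℂ}
    (hz : z ∈ Complex.slitPlane) :
    HasDerivAt (fun z => ∫ t in Ioi (0 : ℝ), macdonaldIntegrand b c z t)
      (-(c : ℂ) / (2 * z ^ 2) * ∫ t in Ioi (0 : ℝ), macdonaldIntegrand (b + 1) (c - 1) z t) z := by
  obtain ⟨K, hK, δ, hδ, H⟩ := macdonald_loc_bound (c - 1) hz
  rw [← integral_const_mul]
  refine (hasDerivAt_integral_of_dominated_loc_of_deriv_le (s := {z | _}) H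
    (bound := fun t => |c| / (2 * δ ^ 2) * (K * (t ^ (b + 1) * Real.exp (-(1 / 2) * t))))
    (F' := fun z t => -(c : ℂ) / (2 * z ^ 2) * macdonaldIntegrand (b + 1) (c - 1) z t)
    ?_ (macdonald_integrable hb c hz) ?_ ?_ ?_ ?_).2
  · filter_upwards [H] with w hw using macdonald_aesm b c hw.1
  · exact (macdonald_aesm _ _ hz).const_mul _
  · filter_upwards [ae_restrict_mem measurableSet_Ioi] with t ht w hw
    rw [norm_mul]
    refine mul_le_mul ?_ (macdonald_norm_le ht (hw.2.2 t (le_of_lt ht))) (norm_nonneg _)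
      (by positivity)
    rw [norm_div, norm_neg, Complex.norm_real, Real.norm_eq_abs, norm_mul, norm_pow]
    have := hw.2.1
    simp only [Complex.norm_ofNat]
    gcongr
  · exact (macdonald_bound_integrable (by linarith) K).const_mul _
  · filter_upwards [ae_restrict_mem measurableSet_Ioi] with t ht w hw
    have ht' : (0 : ℝ) < t := ht
    have hw0 := Complex.slitPlane_ne_zero hw.1
    have h1 : HasDerivAt (fun w : ℂ => 1 + (t : ℂ) / (2 * w)) (-(t : ℂ) / (2 * w ^ 2)) w := by
      have := ((hasDerivAt_inv hw0).const_mul ((t : ℂ) / 2)).const_add 1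
      refine (this.congr_of_eventuallyEq ?_).congr_deriv (by field_simp)
      filter_upwards with x
      simp [div_eq_mul_inv]; ring
    have h2 := (h1.cpow_const (c := (c : ℂ)) (macdonald_base_mem hw.1 ht'.le)).const_mul
      (((Real.exp (-t) * t ^ b : ℝ) : ℂ))
    refine h2.congr_deriv ?_
    simp only [macdonaldIntegrand]
    rw [macdonald_rpow_succ b ht']
    push_cast
    ring

/-- Integration by parts. -/
theorem macdonald_integral_parts {b : ℝ} (hb : -1 < b) (c : ℝ) {z : ℂ}
    (hz : z ∈ Complex.slitPlane) :
    ((b : ℂ) + 1) * (∫ t in Ioi (0 : ℝ), macdonaldIntegrand b c z t) =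
      (∫ t in Ioi (0 : ℝ), macdonaldIntegrand (b + 1) c z t) -
      (c : ℂ) / (2 * z) * ∫ t in Ioi (0 : ℝ), macdonaldIntegrand (b + 1) (c - 1) z t := by
  have hz0 := Complex.slitPlane_ne_zero hz
  have hb1 : 0 < b + 1 := by linarith
  have i0 := (macdonald_integrable hb c hz).const_mul ((b : ℂ) + 1)
  have i1 := macdonald_integrable (b := b + 1) (by linarith) c hz
  have i2 := (macdonald_integrable (b := b + 1) (by linarith) (c - 1) hz).const_mul
    ((c : ℂ) / (2 * z))
  have key := integral_Ioi_of_hasDerivAt_of_tendsto (a := (0 : ℝ)) (m := (0 : ℂ))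
    (f := macdonaldIntegrand (b + 1) c z)
    (f' := fun t => ((b : ℂ) + 1) * macdonaldIntegrand b c z t
      - macdonaldIntegrand (b + 1) c z t
      + (c : ℂ) / (2 * z) * macdonaldIntegrand (b + 1) (c - 1) z t) ?_ ?_ ((i0.sub i1).add i2) ?_
  · have e1 := integral_add (i0.sub i1) i2
    have e2 := integral_sub i0 i1
    simp only [Pi.sub_apply] at e1 e2 key
    rw [e1, e2, integral_const_mul, integral_const_mul] at key
    have h0 : macdonaldIntegrand (b + 1) c z 0 = 0 := by
      simp [macdonaldIntegrand, Real.zero_rpow hb1.ne']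
    rw [h0] at key
    linear_combination key
  · apply ContinuousAt.continuousWithinAt
    unfold macdonaldIntegrand
    refine ContinuousAt.mul ?_ ?_
    · refine Complex.continuous_ofReal.continuousAt.comp ?_
      exact (by fun_prop : ContinuousAt (fun t : ℝ => Real.exp (-t)) 0).mul
        (Real.continuousAt_rpow_const _ _ (Or.inr hb1.le))
    · exact ContinuousAt.cpow (by fun_prop) continuousAt_const (macdonald_base_mem hz le_rfl)
  · intro t ht
    have ht' : (0 : ℝ) < t := ht
    have h1 : HasDerivAt (fun w : ℂ => 1 + w / (2 * z)) (1 / (2 * z)) (t : ℂ) :=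
      ((hasDerivAt_id (t : ℂ)).div_const (2 * z)).const_add 1
    have h2 := (h1.cpow_const (c := (c : ℂ)) (macdonald_base_mem hz ht'.le)).comp_ofReal
    have h3 : HasDerivAt (fun t : ℝ => Real.exp (-t) * t ^ (b + 1))
        (Real.exp (-t) * -1 * t ^ (b + 1) + Real.exp (-t) * ((b + 1) * t ^ (b + 1 - 1))) t :=
      ((hasDerivAt_neg t).exp).mul (Real.hasDerivAt_rpow_const (Or.inl ht'.ne'))
    refine (h3.ofReal_comp.mul h2).congr_deriv ?_
    simp only [macdonaldIntegrand, add_sub_cancel_right]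
    push_cast
    ring
  · obtain ⟨K, hK, δ, hδ, H⟩ := macdonald_loc_bound c hz
    have hlim : Tendsto (fun t : ℝ => K * (t ^ (b + 1) * Real.exp (-(1 / 2) * t))) atTop (𝓝 0) := by
      have := (tendsto_rpow_mul_exp_neg_mul_atTop_nhds_zero (b + 1) (1 / 2)
        (by norm_num)).const_mul K
      simpa using this
    refine squeeze_zero_norm' ?_ hlim
    filter_upwards [eventually_gt_atTop 0] with t ht
    exact macdonald_norm_le ht (H.self_of_nhds.2.2 t ht.le)

theorem macdonald_prefactor_hasDerivAt {z : ℂ} (hz : z ∈ Complex.slitPlane) (A : ℂ) :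
    HasDerivAt (fun z : ℂ => A * Complex.exp (-z) * z ^ (-(1 / 2) : ℂ))
      (A * Complex.exp (-z) * z ^ (-(1 / 2) : ℂ) * (-1 - 1 / (2 * z))) z := by
  have hz0 := Complex.slitPlane_ne_zero hz
  have h1 := ((hasDerivAt_neg z).cexp.const_mul A).mul
    ((hasDerivAt_id z).cpow_const (c := (-(1 / 2) : ℂ)) hz)
  refine h1.congr_deriv ?_
  rw [id, Complex.cpow_sub _ _ hz0, Complex.cpow_one]
  field_simp
  ring

/-- The first derivative of `macdonaldK`. -/
theorem macdonaldK_hasDerivAt {μ : ℝ} (hμ : -(1 / 2) < μ) {z : ℂ} (hz : z ∈ Complex.slitPlane) :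
    HasDerivAt (macdonaldK μ)
      (((Real.sqrt (Real.pi / 2) / Real.Gamma (μ + 1 / 2) : ℝ) : ℂ) * Complex.exp (-z)
        * z ^ (-(1 / 2) : ℂ) *
        ((-1 - 1 / (2 * z)) * (∫ t in Ioi (0 : ℝ), macdonaldIntegrand (μ - 1 / 2) (μ - 1 / 2) z t)
          + -((μ - 1 / 2 : ℝ) : ℂ) / (2 * z ^ 2) * ∫ t in Ioi (0 : ℝ),
            macdonaldIntegrand (μ - 1 / 2 + 1) (μ - 1 / 2 - 1) z t)) z := by
  have h := (macdonald_prefactor_hasDerivAt hz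
    ((Real.sqrt (Real.pi / 2) / Real.Gamma (μ + 1 / 2) : ℝ) : ℂ)).mul
    (macdonald_integral_hasDerivAt (b := μ - 1 / 2) (by linarith) (μ - 1 / 2) hz)
  refine h.congr_deriv ?_
  ring

/-- `K_μ` is holomorphic on the slit plane. -/
theorem macdonaldK_differentiableOn {μ : ℝ} (hμ : -(1 / 2) < μ) :
    DifferentiableOn ℂ (macdonaldK μ) Complex.slitPlane := fun _ hz =>
  (macdonaldK_hasDerivAt hμ hz).differentiableAt.differentiableWithinAt

/-- `K_μ` solves the modified Bessel equation on the slit plane. -/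
theorem macdonaldK_bessel_equation {μ : ℝ} (hμ : -(1 / 2) < μ) {z : ℂ}
    (hz : z ∈ Complex.slitPlane) :
    z ^ 2 * deriv (deriv (macdonaldK μ)) z + z * deriv (macdonaldK μ) z
      - (z ^ 2 + (μ : ℂ) ^ 2) * macdonaldK μ z = 0 := by
  have hz0 := Complex.slitPlane_ne_zero hz
  have hev : deriv (macdonaldK μ) =ᶠ[𝓝 z] _ :=
    Filter.eventuallyEq_of_mem (Complex.isOpen_slitPlane.mem_nhds hz)
      fun w hw => (macdonaldK_hasDerivAt hμ hw).deriv
  have hc : HasDerivAt (fun w : ℂ => -1 - 1 / (2 * w)) (1 / (2 * z ^ 2)) z := by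
    have := ((hasDerivAt_inv hz0).const_mul (1 / 2 : ℂ)).const_sub (-1)
    refine (this.congr_of_eventuallyEq ?_).congr_deriv (by field_simp)
    filter_upwards with x
    simp [div_eq_mul_inv]; ring
  have hd : HasDerivAt (fun w : ℂ => -((μ - 1 / 2 : ℝ) : ℂ) / (2 * w ^ 2))
      (((μ - 1 / 2 : ℝ) : ℂ) / z ^ 3) z := by
    have := (((hasDerivAt_pow 2 z).const_mul 2).inv (by simpa using hz0)).const_mul
      (-((μ - 1 / 2 : ℝ) : ℂ))
    refine this.congr_deriv ?_
    field_simp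
    ring
  have hb : -1 < μ - 1 / 2 := by linarith
  have hb' : -1 < μ - 1 / 2 + 1 := by linarith
  have h0 := macdonald_integral_hasDerivAt hb (μ - 1 / 2) hz
  have h1 := macdonald_integral_hasDerivAt hb' (μ - 1 / 2 - 1) hz
  have hD := (macdonald_prefactor_hasDerivAt hz
    ((Real.sqrt (Real.pi / 2) / Real.Gamma (μ + 1 / 2) : ℝ) : ℂ)).mul
    ((hc.mul h0).add (hd.mul h1))
  have h2 := (hD.congr_of_eventuallyEq hev).deriv
  have e1 := macdonald_integral_parts hb (μ - 1 / 2) hz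
  have e2 := macdonald_integral_split hb' (μ - 1 / 2) hz
  have e3 := macdonald_integral_parts hb' (μ - 1 / 2 - 1) hz
  rw [h2, (macdonaldK_hasDerivAt hμ hz).deriv, macdonaldK]
  simp only [Pi.add_apply, Pi.mul_apply]
  set P := ((Real.sqrt (Real.pi / 2) / Real.Gamma (μ + 1 / 2) : ℝ) : ℂ) * Complex.exp (-z)
        * z ^ (-(1 / 2) : ℂ)
  set G0 := ∫ t in Ioi (0 : ℝ), macdonaldIntegrand (μ - 1 / 2) (μ - 1 / 2) z t
  set G1 := ∫ t in Ioi (0 : ℝ), macdonaldIntegrand (μ - 1 / 2 + 1) (μ - 1 / 2 - 1) z t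
  set G2 := ∫ t in Ioi (0 : ℝ), macdonaldIntegrand (μ - 1 / 2 + 1 + 1) (μ - 1 / 2 - 1 - 1) z t
  set X := ∫ t in Ioi (0 : ℝ), macdonaldIntegrand (μ - 1 / 2 + 1) (μ - 1 / 2) z t
  set Y := ∫ t in Ioi (0 : ℝ), macdonaldIntegrand (μ - 1 / 2 + 1 + 1) (μ - 1 / 2 - 1) z t
  push_cast at e1 e2 e3 ⊢
  have e4 : ((μ : ℂ) + 1 / 2) * G0 = (1 + 1 / z) * G1 + ((μ : ℂ) - 3 / 2) / (4 * z ^ 2) * G2 := by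
    have e3' : Y = ((μ : ℂ) + 3 / 2) * G1 + ((μ : ℂ) - 3 / 2) / (2 * z) * G2 := by
      linear_combination -e3
    rw [e2, e3'] at e1
    field_simp at e1 ⊢
    linear_combination e1
  rw [← sub_eq_zero] at e4
  trans -P * ((μ : ℂ) - 1 / 2) * (((μ : ℂ) + 1 / 2) * G0
    - ((1 + 1 / z) * G1 + ((μ : ℂ) - 3 / 2) / (4 * z ^ 2) * G2))
  · field_simp
    ring
  · rw [e4, mul_zero]

/-- `K_μ(x) ∼ √(π/(2x)) e^{-x}` as `x → +∞`. -/
theorem macdonaldK_tendsto {μ : ℝ} (hμ : -(1 / 2) < μ) :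
    Tendsto (fun x : ℝ => macdonaldK μ x / ((Real.sqrt (Real.pi / (2 * x)) * Real.exp (-x) : ℝ) : ℂ))
      atTop (𝓝 1) := by
  have hb : -1 < μ - 1 / 2 := by linarith
  obtain ⟨K, hK, H⟩ := macdonald_rpow_bound (1 / 2) 1 (μ - 1 / 2) (by norm_num) one_pos
  have hlim : Tendsto (fun x : ℝ => ∫ t in Ioi (0 : ℝ),
      macdonaldIntegrand (μ - 1 / 2) (μ - 1 / 2) (x : ℂ) t) atTop
      (𝓝 (∫ t in Ioi (0 : ℝ), ((Real.exp (-t) * t ^ (μ - 1 / 2) : ℝ) : ℂ))) := by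
    refine tendsto_integral_filter_of_dominated_convergence _ ?_ ?_
      (macdonald_bound_integrable hb K) ?_
    · filter_upwards [eventually_gt_atTop 0] with x hx
      exact macdonald_aesm _ _ (Complex.ofReal_mem_slitPlane.2 hx)
    · filter_upwards [eventually_ge_atTop 1] with x hx
      filter_upwards [ae_restrict_mem measurableSet_Ioi] with t ht
      have ht' : (0 : ℝ) < t := ht
      apply macdonald_norm_le ht
      have hx0 : 0 < x := by linarith
      have hcast : 1 + (t : ℂ) / (2 * (x : ℂ)) = ((1 + t / (2 * x) : ℝ) : ℂ) := by push_cast; rfl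
      have hpos : 0 < 1 + t / (2 * x) := by positivity
      rw [macdonald_norm_cpow _ (by rw [hcast]; exact_mod_cast hpos.ne'), hcast,
        Complex.norm_real, Real.norm_of_nonneg hpos.le]
      apply H t ht'.le
      · have : 0 ≤ t / (2 * x) := by positivity
        linarith
      · have : t / (2 * x) ≤ t / 2 := by gcongr; linarith
        linarith
    · filter_upwards [ae_restrict_mem measurableSet_Ioi] with t ht
      have h1 : Tendsto (fun x : ℝ => 1 + (t : ℂ) / (2 * (x : ℂ))) atTop (𝓝 1) := by
        have h2 : Tendsto (fun x : ℝ => 1 + t / 2 * x⁻¹) atTop (𝓝 (1 + t / 2 * 0)) :=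
          (tendsto_inv_atTop_zero.const_mul _).const_add _
        have h3 := (Complex.continuous_ofReal.tendsto _).comp h2
        simp only [mul_zero, add_zero, Complex.ofReal_one] at h3
        refine h3.congr fun x => ?_
        simp [div_eq_mul_inv]; ring
      have h4 := (continuousAt_cpow_const (b := ((μ - 1 / 2 : ℝ) : ℂ))
        Complex.one_mem_slitPlane).tendsto.comp h1
      have h5 := h4.const_mul ((Real.exp (-t) * t ^ (μ - 1 / 2) : ℝ) : ℂ)
      simpa [macdonaldIntegrand, Function.comp_def] using h5
  have hG : (∫ t in Ioi (0 : ℝ), ((Real.exp (-t) * t ^ (μ - 1 / 2) : ℝ) : ℂ))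
      = (Real.Gamma (μ + 1 / 2) : ℂ) := by
    rw [integral_complex_ofReal, Real.Gamma_eq_integral (by linarith)]
    congr 3
    ext t
    ring_nf
  rw [hG] at hlim
  have hΓ : Real.Gamma (μ + 1 / 2) ≠ 0 := (Real.Gamma_pos_of_pos (by linarith)).ne'
  have h6 := hlim.const_mul ((Real.Gamma (μ + 1 / 2) : ℂ)⁻¹)
  rw [inv_mul_cancel₀ (by exact_mod_cast hΓ)] at h6
  refine h6.congr' ?_
  filter_upwards [eventually_gt_atTop 0] with x hx
  have hp : (x : ℂ) ^ (-(1 / 2) : ℂ) = (((Real.sqrt x)⁻¹ : ℝ) : ℂ) := by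
    rw [Real.sqrt_eq_rpow, ← Real.rpow_neg hx.le, Complex.ofReal_cpow hx.le]
    push_cast; rfl
  have hs : Real.sqrt (Real.pi / (2 * x)) = Real.sqrt (Real.pi / 2) * (Real.sqrt x)⁻¹ := by
    rw [← div_div, Real.sqrt_div (by positivity), div_eq_mul_inv]
  have h7 : ((Real.sqrt (Real.pi / 2) : ℝ) : ℂ) ≠ 0 := by
    exact_mod_cast (Real.sqrt_pos.2 (by positivity)).ne'
  have h8 : ((Real.sqrt x : ℝ) : ℂ) ≠ 0 := by exact_mod_cast (Real.sqrt_pos.2 hx).ne'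
  have h9 : (Real.Gamma (μ + 1 / 2) : ℂ) ≠ 0 := by exact_mod_cast hΓ
  have h10 := Complex.exp_ne_zero (-(x : ℂ))
  rw [macdonaldK, hp, hs]
  push_cast
  field_simp

end MacdonaldFacts

/-! Write `I(b,c,z)` for `macdonaldIntegral b c z`. Then `e^z K_μ(z)` is `√(π/2) z^{-1/2} I(b,b,z) /
Γ(b+1)` with `b = μ - 1/2`, so everything reduces to bounds on `I`. The recurrence
`macdonaldIntegral_succ_succ` cancels the leading terms of `K_μ - K_{μ+1}`, leaving `z^{-1} I(μ+1/2,
μ-1/2, z)` up to a constant and the factor `z^{-1/2}`.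

If `μ ≥ 1/2`, the inner exponent is nonnegative and the triangle inequality replaces `z` by `r =
|z|`. The real integral `F(r) = I(b,b,r)` tends to `Γ(b+1)` at infinity, and integration by parts
gives `-F' ≤ b(b+1)/(2r²) F`. Integrating from infinity yields `F(r) ≤ Γ(b+1) exp(b(b+1)/(2r))`
(`macdonaldRealIntegral_le_exp`), hence (a) and (b). Near the origin, `F(r)` is compared with its
value at a fixed larger radius (`macdonaldRealIntegral_le_scale`).

If `μ = 0`, the inner exponent is `-1/2`, and `1 + t/(2z)` may nearly vanish when `z` is close to
the negative axis. For `Re z ≥ 0` its modulus is at least `1`. Otherwise conjugation gives `Im z >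
0`, and the path is turned onto the ray through `(4+3i)/5` (`macdonaldIntegral_eq_rotated`), where
the modulus is at least `3/5`. The constant in (a) must still be sharp as `|z| → ∞`, so crude bounds
do not suffice: `(1+x)^{-1/2}` is expanded to first and second order with explicit remainders
(`inv_sqrt_expansion`), and the two estimates together cover all `|z|`. The bounds for small `|z|`
use the decay `|1+x|^{-1/2} ≲ |x|^{-1/2}`; the logarithm in (c) comes from `∫ ds/s` between `|z|`
and `R`.

The global bounds combine (a) and (b) on `|z| ≥ 1` with local bounds on `|z| ≤ 1`. -/

/-! ### The integral on the slit plane and on the positive axis -/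

/-- The integral of `macdonaldIntegrand b c z` over the positive half-line. -/
noncomputable def macdonaldIntegral (b c : ℝ) (z : ℂ) : ℂ :=
  ∫ t in Ioi (0 : ℝ), macdonaldIntegrand b c z t

theorem macdonaldIntegral_def (b c : ℝ) (z : ℂ) :
    macdonaldIntegral b c z = ∫ t in Ioi (0 : ℝ), macdonaldIntegrand b c z t := rfl

/-- The real counterpart of `macdonaldIntegral`. -/
noncomputable def macdonaldRealIntegral (b c r : ℝ) : ℝ :=
  ∫ t in Ioi (0 : ℝ), Real.exp (-t) * t ^ b * (1 + t / (2 * r)) ^ c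

theorem macdonaldIntegrand_ofReal (b c : ℝ) {r t : ℝ} (hr : 0 < r) (ht : 0 ≤ t) :
    macdonaldIntegrand b c (r : ℂ) t =
      ((Real.exp (-t) * t ^ b * (1 + t / (2 * r)) ^ c : ℝ) : ℂ) := by
  have h : (1 + (t : ℂ) / (2 * (r : ℂ))) = ((1 + t / (2 * r) : ℝ) : ℂ) := by push_cast; rfl
  rw [macdonaldIntegrand, h, ← Complex.ofReal_cpow (by positivity), ← Complex.ofReal_mul]

theorem macdonaldIntegral_ofReal (b c : ℝ) {r : ℝ} (hr : 0 < r) :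
    macdonaldIntegral b c (r : ℂ) = (macdonaldRealIntegral b c r : ℂ) := by
  rw [macdonaldIntegral, macdonaldRealIntegral, ← integral_complex_ofReal]
  exact setIntegral_congr_fun measurableSet_Ioi fun t ht =>
    macdonaldIntegrand_ofReal b c hr (le_of_lt ht)

theorem macdonaldRealIntegrand_integrable {b : ℝ} (hb : -1 < b) (c : ℝ) {r : ℝ} (hr : 0 < r) :
    IntegrableOn (fun t : ℝ => Real.exp (-t) * t ^ b * (1 + t / (2 * r)) ^ c) (Ioi 0) := by
  have h := (macdonald_integrable hb c (Complex.ofReal_mem_slitPlane.2 hr)).re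
  refine (integrableOn_congr_fun (fun t ht => ?_) measurableSet_Ioi).1 h
  simp only [macdonaldIntegrand_ofReal b c hr (le_of_lt ht)]
  exact Complex.ofReal_re _

theorem macdonaldRealIntegral_nonneg (b c : ℝ) {r : ℝ} (hr : 0 < r) :
    0 ≤ macdonaldRealIntegral b c r := by
  refine setIntegral_nonneg measurableSet_Ioi fun t ht => ?_
  have ht' : (0 : ℝ) < t := ht
  positivity

theorem norm_macdonaldIntegral_le {b c : ℝ} (hb : -1 < b) (hc : 0 ≤ c) {z : ℂ}
    (hz : z ∈ Complex.slitPlane) :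
    ‖macdonaldIntegral b c z‖ ≤ macdonaldRealIntegral b c ‖z‖ := by
  have hr : 0 < ‖z‖ := norm_pos_iff.2 (Complex.slitPlane_ne_zero hz)
  refine norm_integral_le_of_norm_le (macdonaldRealIntegrand_integrable hb c hr) ?_
  filter_upwards [ae_restrict_mem measurableSet_Ioi] with t ht
  have ht' : (0 : ℝ) < t := ht
  rw [macdonaldIntegrand, norm_mul, Complex.norm_real, Real.norm_of_nonneg (by positivity),
    macdonald_norm_cpow _ (Complex.slitPlane_ne_zero (macdonald_base_mem hz ht'.le))]
  gcongr
  refine (norm_add_le _ _).trans ?_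
  simp [abs_of_pos ht']

theorem macdonaldRealIntegral_split {b : ℝ} (hb : -1 < b) (c : ℝ) {r : ℝ} (hr : 0 < r) :
    macdonaldRealIntegral b c r = macdonaldRealIntegral b (c - 1) r +
      1 / (2 * r) * macdonaldRealIntegral (b + 1) (c - 1) r := by
  have h := macdonald_integral_split hb c (Complex.ofReal_mem_slitPlane.2 hr)
  simp only [← macdonaldIntegral_def, macdonaldIntegral_ofReal _ _ hr] at h
  exact_mod_cast h

theorem macdonaldRealIntegral_parts {b : ℝ} (hb : -1 < b) (c : ℝ) {r : ℝ} (hr : 0 < r) :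
    (b + 1) * macdonaldRealIntegral b c r = macdonaldRealIntegral (b + 1) c r -
      c / (2 * r) * macdonaldRealIntegral (b + 1) (c - 1) r := by
  have h := macdonald_integral_parts hb c (Complex.ofReal_mem_slitPlane.2 hr)
  simp only [← macdonaldIntegral_def, macdonaldIntegral_ofReal _ _ hr] at h
  exact_mod_cast h

theorem macdonaldRealIntegral_lower_le {b c : ℝ} (hb : -1 < b) {r : ℝ} (hr : 0 < r) :
    1 / (2 * r) * macdonaldRealIntegral (b + 1) (c - 1) r ≤ macdonaldRealIntegral b c r := by
  have h := macdonaldRealIntegral_split hb c hr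
  have := macdonaldRealIntegral_nonneg b (c - 1) hr
  linarith

/-- This controls the logarithmic derivative of `macdonaldRealIntegral b b`. Two integrations by
parts and one splitting write the difference of the two sides as `1/(2r)` times a combination of
integrals that is nonnegative. -/
theorem macdonaldRealIntegral_raise_le {b : ℝ} (hb : 0 ≤ b) {r : ℝ} (hr : 0 < r) :
    macdonaldRealIntegral (b + 1) (b - 1) r ≤ (b + 1) * macdonaldRealIntegral b b r := by
  have e1 := macdonaldRealIntegral_parts (b := b) (by linarith) b hr
  have e2 := macdonaldRealIntegral_split (b := b + 1) (by linarith) b hr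
  have e3 := macdonaldRealIntegral_parts (b := b + 1) (by linarith) (b - 1) hr
  have e4 := macdonaldRealIntegral_lower_le (b := b + 1) (c := b - 1) (by linarith) hr
  have p := macdonaldRealIntegral_nonneg (b + 1 + 1) (b - 1 - 1) hr
  have hr2 : 0 < 1 / (2 * r) := by positivity
  set X := macdonaldRealIntegral (b + 1) (b - 1) r
  set Z := macdonaldRealIntegral (b + 1 + 1) (b - 1) r
  set Y := macdonaldRealIntegral (b + 1 + 1) (b - 1 - 1) r
  set V := macdonaldRealIntegral (b + 1) b r
  have hY : 0 ≤ 1 / (2 * r) * Y := by positivity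
  have e5 : (b + 1) * macdonaldRealIntegral b b r =
      X + 1 / (2 * r) * (2 * X + (b - 1) * (1 / (2 * r) * Y)) := by
    rw [e1, e2]
    have : Z = (b + 1 + 1) * X + (b - 1) / (2 * r) * Y := by linarith
    rw [this]; ring
  -- Only `b < 1` could spoil the sign; there `e4`, that is `Y/(2r) ≤ X`, absorbs the negative term.
  have e6 : 0 ≤ 2 * X + (b - 1) * (1 / (2 * r) * Y) := by nlinarith
  rw [e5]
  have := mul_nonneg hr2.le e6
  linarith

theorem macdonaldRealIntegral_hasDerivAt {b : ℝ} (hb : -1 < b) (c : ℝ) {r : ℝ} (hr : 0 < r) :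
    HasDerivAt (macdonaldRealIntegral b c)
      (-c / (2 * r ^ 2) * macdonaldRealIntegral (b + 1) (c - 1) r) r := by
  have h := macdonald_integral_hasDerivAt hb c (Complex.ofReal_mem_slitPlane.2 hr)
  simp only [← macdonaldIntegral_def] at h
  have h2 := h.real_of_complex
  rw [macdonaldIntegral_ofReal _ _ hr] at h2
  have e : (-(c : ℂ) / (2 * (r : ℂ) ^ 2) * (macdonaldRealIntegral (b + 1) (c - 1) r : ℂ)).re =
      -c / (2 * r ^ 2) * macdonaldRealIntegral (b + 1) (c - 1) r := by
    norm_cast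
  rw [e] at h2
  refine h2.congr_of_eventuallyEq ?_
  filter_upwards [lt_mem_nhds hr] with x hx
  rw [macdonaldIntegral_ofReal _ _ hx, Complex.ofReal_re]

/-! ### Reduction of `macdonaldK` to the integral, and the exponential bound for `μ ≥ 1/2` -/

theorem macdonaldK_eq (μ : ℝ) (z : ℂ) :
    macdonaldK μ z = ((Real.sqrt (Real.pi / 2) / Real.Gamma (μ + 1 / 2) : ℝ) : ℂ)
      * Complex.exp (-z) * z ^ (-(1 / 2) : ℂ) * macdonaldIntegral (μ - 1 / 2) (μ - 1 / 2) z := rfl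

theorem exp_mul_macdonaldK (μ : ℝ) (z : ℂ) :
    Complex.exp z * macdonaldK μ z = ((Real.sqrt (Real.pi / 2) / Real.Gamma (μ + 1 / 2) : ℝ) : ℂ)
      * z ^ (-(1 / 2) : ℂ) * macdonaldIntegral (μ - 1 / 2) (μ - 1 / 2) z := by
  have h : Complex.exp z * Complex.exp (-z) = 1 := by rw [← Complex.exp_add]; simp
  rw [macdonaldK_eq]
  linear_combination (((Real.sqrt (Real.pi / 2) / Real.Gamma (μ + 1 / 2) : ℝ) : ℂ)
      * z ^ (-(1 / 2) : ℂ) * macdonaldIntegral (μ - 1 / 2) (μ - 1 / 2) z) * h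

theorem sqrt_pi_div_two_mul {r : ℝ} (hr : 0 < r) :
    Real.sqrt (Real.pi / (2 * r)) = Real.sqrt (Real.pi / 2) * r ^ (-(1 / 2) : ℝ) := by
  rw [← div_div, Real.sqrt_div (by positivity), Real.rpow_neg hr.le, ← Real.sqrt_eq_rpow,
    div_eq_mul_inv]

/-- This is the asymptotics `macdonaldK_tendsto` for `μ = b + 1/2`, with the elementary factors
cancelled. -/
theorem macdonaldRealIntegral_tendsto {b : ℝ} (hb : -1 < b) :
    Tendsto (macdonaldRealIntegral b b) atTop (𝓝 (Real.Gamma (b + 1))) := by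
  have h := macdonaldK_tendsto (μ := b + 1 / 2) (by linarith)
  have hΓ : 0 < Real.Gamma (b + 1) := Real.Gamma_pos_of_pos (by linarith)
  have h2 := (Complex.continuous_re.tendsto _).comp h
  have h3 := h2.const_mul (Real.Gamma (b + 1))
  simp only [Complex.one_re, mul_one] at h3
  refine h3.congr' ?_
  filter_upwards [eventually_gt_atTop 0] with x hx
  have hp : (x : ℂ) ^ (-(1 / 2) : ℂ) = ((x ^ (-(1 / 2) : ℝ) : ℝ) : ℂ) := by
    rw [Complex.ofReal_cpow hx.le]; push_cast; rfl
  have hs : 0 < Real.sqrt (Real.pi / 2) := Real.sqrt_pos.2 (by positivity)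
  have hq : 0 < x ^ (-(1 / 2) : ℝ) := by positivity
  have e := Real.exp_pos (-x)
  have hh : b + 1 / 2 + 1 / 2 = b + 1 := by ring
  rw [Function.comp_apply, macdonaldK_eq, hp, sqrt_pi_div_two_mul hx, add_sub_cancel_right,
    macdonaldIntegral_ofReal _ _ hx, hh, ← Complex.ofReal_neg, ← Complex.ofReal_exp]
  norm_cast
  field_simp

/-- The bound `Γ(b+1)⁻¹ ∫ e^{-t} t^b (1 + t/(2r))^b dt ≤ exp (b(b+1)/(2r))`. -/
theorem macdonaldRealIntegral_le_exp {b : ℝ} (hb : 0 ≤ b) {r : ℝ} (hr : 0 < r) :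
    macdonaldRealIntegral b b r ≤ Real.Gamma (b + 1) * Real.exp (b * (b + 1) / (2 * r)) := by
  -- Grönwall's argument from infinity: the factor `exp(-b(b+1)/(2x))` makes the product
  -- nondecreasing, so its value at `r` is at most its limit.
  set g : ℝ → ℝ := fun x => macdonaldRealIntegral b b x * Real.exp (-(b * (b + 1) / 2) * x⁻¹) with hg
  have hd : ∀ x : ℝ, 0 < x → HasDerivAt g
      (-b / (2 * x ^ 2) * macdonaldRealIntegral (b + 1) (b - 1) x
          * Real.exp (-(b * (b + 1) / 2) * x⁻¹)
        + macdonaldRealIntegral b b x * (Real.exp (-(b * (b + 1) / 2) * x⁻¹)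
          * (-(b * (b + 1) / 2) * (-(x ^ 2)⁻¹)))) x := fun x hx =>
    (macdonaldRealIntegral_hasDerivAt (by linarith) b hx).mul
      (((hasDerivAt_inv hx.ne').const_mul _).exp)
  have hmono : MonotoneOn g (Ioi 0) := by
    refine monotoneOn_of_deriv_nonneg (convex_Ioi 0)
      (fun x hx => (hd x hx).continuousAt.continuousWithinAt) ?_ ?_
    · rw [interior_Ioi]
      exact fun x hx => (hd x hx).differentiableAt.differentiableWithinAt
    · rw [interior_Ioi]
      intro x hx
      have hx' : (0 : ℝ) < x := hx
      rw [(hd x hx).deriv]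
      have h1 := macdonaldRealIntegral_raise_le hb hx'
      have e : -b / (2 * x ^ 2) * macdonaldRealIntegral (b + 1) (b - 1) x
          * Real.exp (-(b * (b + 1) / 2) * x⁻¹)
        + macdonaldRealIntegral b b x * (Real.exp (-(b * (b + 1) / 2) * x⁻¹)
          * (-(b * (b + 1) / 2) * (-(x ^ 2)⁻¹))) =
          b / (2 * x ^ 2) * Real.exp (-(b * (b + 1) / 2) * x⁻¹) *
          ((b + 1) * macdonaldRealIntegral b b x - macdonaldRealIntegral (b + 1) (b - 1) x) := by
        field_simp
        ring
      rw [e]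
      exact mul_nonneg (by positivity) (by linarith)
  have hlim : Tendsto g atTop (𝓝 (Real.Gamma (b + 1))) := by
    have h1 : Tendsto (fun x : ℝ => Real.exp (-(b * (b + 1) / 2) * x⁻¹)) atTop (𝓝 1) := by
      have := (Real.continuous_exp.tendsto _).comp
        (tendsto_inv_atTop_zero.const_mul (-(b * (b + 1) / 2)))
      simpa [Function.comp_def] using this
    simpa [hg] using (macdonaldRealIntegral_tendsto (b := b) (by linarith)).mul h1
  have hle : g r ≤ Real.Gamma (b + 1) := by
    refine ge_of_tendsto hlim ?_
    filter_upwards [eventually_ge_atTop r] with x hx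
    exact hmono hr (lt_of_lt_of_le hr hx) hx
  have e : -(b * (b + 1) / 2) * r⁻¹ = -(b * (b + 1) / (2 * r)) := by field_simp
  simp only [hg, e, Real.exp_neg] at hle
  have := Real.exp_pos (b * (b + 1) / (2 * r))
  rwa [← div_eq_mul_inv, div_le_iff₀ this] at hle

/-- Integration by parts gives one term with exponents `(b+1, b)`, and splitting off a factor of the
base gives another. Dividing by `Γ(b+2) = (b+1) Γ(b+1)` turns the first summand into the one
belonging to `K_μ`, which is why the difference gains a factor `1/z`. -/
theorem macdonaldIntegral_succ_succ {b : ℝ} (hb : -1 < b) {z : ℂ} (hz : z ∈ Complex.slitPlane) :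
    macdonaldIntegral (b + 1) (b + 1) z =
      ((b : ℂ) + 1) * (macdonaldIntegral b b z + 1 / z * macdonaldIntegral (b + 1) b z) := by
  have h1 := macdonald_integral_parts hb (b + 1) hz
  have h2 := macdonald_integral_split hb (b + 1) hz
  simp only [← macdonaldIntegral_def, add_sub_cancel_right] at h1 h2
  rw [h2] at h1
  have hz0 := Complex.slitPlane_ne_zero hz
  push_cast at h1
  field_simp at h1 ⊢
  linear_combination -h1 / 2

theorem norm_exp_mul_macdonaldK {μ : ℝ} (hμ : -(1 / 2) < μ) {z : ℂ} (hz : z ∈ Complex.slitPlane) :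
    ‖Complex.exp z * macdonaldK μ z‖ = Real.sqrt (Real.pi / 2) * ‖z‖ ^ (-(1 / 2) : ℝ) *
      (‖macdonaldIntegral (μ - 1 / 2) (μ - 1 / 2) z‖ / Real.Gamma (μ + 1 / 2)) := by
  have hΓ : 0 < Real.Gamma (μ + 1 / 2) := Real.Gamma_pos_of_pos (by linarith)
  have h := macdonald_norm_cpow (-(1 / 2)) (Complex.slitPlane_ne_zero hz)
  push_cast at h
  rw [exp_mul_macdonaldK, norm_mul, norm_mul, Complex.norm_real,
    Real.norm_of_nonneg (by positivity), h]
  ring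

theorem norm_exp_mul_macdonaldK_sub {μ : ℝ} (hμ : -(1 / 2) < μ) {z : ℂ}
    (hz : z ∈ Complex.slitPlane) :
    ‖Complex.exp z * (macdonaldK μ z - macdonaldK (μ + 1) z)‖ =
      Real.sqrt (Real.pi / 2) * ‖z‖ ^ (-(3 / 2) : ℝ) *
      (‖macdonaldIntegral (μ + 1 / 2) (μ - 1 / 2) z‖ / Real.Gamma (μ + 1 / 2)) := by
  have hΓ : 0 < Real.Gamma (μ + 1 / 2) := Real.Gamma_pos_of_pos (by linarith)
  have hz0 := Complex.slitPlane_ne_zero hz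
  have hr : 0 < ‖z‖ := norm_pos_iff.2 hz0
  have h := macdonald_norm_cpow (-(1 / 2)) hz0
  push_cast at h
  have h1 := macdonaldIntegral_succ_succ (b := μ - 1 / 2) (by linarith) hz
  have hG : Real.Gamma (μ + 1 + 1 / 2) = (μ + 1 / 2) * Real.Gamma (μ + 1 / 2) := by
    rw [← Real.Gamma_add_one (by linarith)]; ring_nf
  have e : Complex.exp z * (macdonaldK μ z - macdonaldK (μ + 1) z) =
      -(((Real.sqrt (Real.pi / 2) / Real.Gamma (μ + 1 / 2) : ℝ) : ℂ)
      * z ^ (-(1 / 2) : ℂ) * (z⁻¹ * macdonaldIntegral (μ + 1 / 2) (μ - 1 / 2) z)) := by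
    rw [mul_sub, exp_mul_macdonaldK, exp_mul_macdonaldK, hG]
    have e1 : μ + 1 - 1 / 2 = μ - 1 / 2 + 1 := by ring
    have e2 : μ + 1 / 2 = μ - 1 / 2 + 1 := by ring
    rw [e1, h1, e2]
    have h3 : ((μ : ℂ) + 1 / 2) ≠ 0 := by
      have : ((μ + 1 / 2 : ℝ) : ℂ) ≠ 0 := Complex.ofReal_ne_zero.2 (by linarith)
      simpa using this
    have h4 : (Real.Gamma (μ - 1 / 2 + 1) : ℂ) ≠ 0 := by
      rw [← e2]; exact_mod_cast hΓ.ne'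
    have e3 : ((μ - 1 / 2 : ℝ) : ℂ) + 1 = μ + 1 / 2 := by push_cast; ring
    have e5 : ((μ - 1 / 2 + 1 : ℝ) : ℂ) = μ + 1 / 2 := by push_cast; ring
    rw [e3]
    simp only [Complex.ofReal_div, Complex.ofReal_mul, e5]
    generalize (μ : ℂ) + 1 / 2 = m at h3 ⊢
    field_simp
    ring
  have e4 : ‖z‖ ^ (-(3 / 2) : ℝ) = ‖z‖ ^ (-(1 / 2) : ℝ) * ‖z‖⁻¹ := by
    rw [← Real.rpow_neg_one, ← Real.rpow_add hr]; norm_num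
  rw [e, norm_neg, norm_mul, norm_mul, norm_mul, Complex.norm_real,
    Real.norm_of_nonneg (by positivity), h, e4, norm_inv]
  ring

/-! ### Rotation of the path of integration -/

/-- The integrand of `macdonaldIntegral` along the ray through `ω`, without the constant factor
`ω^(b+1)`. -/
noncomputable def rotatedIntegrand (b c : ℝ) (z ω : ℂ) (s : ℝ) : ℂ :=
  ((s ^ b : ℝ) : ℂ) * Complex.exp (-(ω * s)) * (1 + ω * s / (2 * z)) ^ (c : ℂ)

theorem rotated_base_eq {z ω : ℂ} (hω : ω ≠ 0) (s : ℝ) :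
    1 + ω * s / (2 * z) = 1 + (s : ℂ) / (2 * (z / ω)) := by
  congr 1
  rcases eq_or_ne z 0 with rfl | hz
  · simp
  · field_simp

theorem rotated_base_mem {z ω : ℂ} (hω : ω ≠ 0) (h : z / ω ∈ Complex.slitPlane) {s : ℝ}
    (hs : 0 ≤ s) : 1 + ω * s / (2 * z) ∈ Complex.slitPlane := by
  rw [rotated_base_eq hω]
  exact macdonald_base_mem h hs

theorem rotated_aesm (b c : ℝ) {z ω : ℂ} (hω : ω ≠ 0) (h : z / ω ∈ Complex.slitPlane) :
    AEStronglyMeasurable (rotatedIntegrand b c z ω) (volume.restrict (Ioi 0)) := by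
  apply ContinuousOn.aestronglyMeasurable _ measurableSet_Ioi
  intro s hs
  have hs' : (0 : ℝ) < s := hs
  apply ContinuousAt.continuousWithinAt
  unfold rotatedIntegrand
  refine ContinuousAt.mul (ContinuousAt.mul ?_ (by fun_prop)) ?_
  · exact Complex.continuous_ofReal.continuousAt.comp
      (Real.continuousAt_rpow_const _ _ (Or.inl hs'.ne'))
  · exact ContinuousAt.cpow (by fun_prop) continuousAt_const (rotated_base_mem hω h hs'.le)

/-- Local uniformity in the direction `ω`, as needed to differentiate under the integral sign: `m`
is a rate of exponential decay, and `δ` keeps the base away from zero, which is all that a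
nonpositive exponent requires. -/
theorem rotated_loc_bound {z ω₀ : ℂ} (hre : 0 < ω₀.re) (h : z / ω₀ ∈ Complex.slitPlane) :
    ∃ m, 0 < m ∧ ∃ δ, 0 < δ ∧ ∀ᶠ ω in 𝓝 ω₀, m ≤ ω.re ∧ z / ω ∈ Complex.slitPlane ∧
      ∀ s : ℝ, 0 ≤ s → δ ≤ ‖1 + ω * s / (2 * z)‖ := by
  have hω₀ : ω₀ ≠ 0 := by rintro rfl; simp at hre
  have hz0 : z ≠ 0 := by rintro rfl; simp at h
  -- With `ζ = z/ω`, the base is `(2ζ + s)/(2ζ)`, and `macdonald_m_le` bounds its numerator below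
  -- uniformly in `s`.
  set F : ℂ → ℝ := fun ω => max (z / ω).re |(z / ω).im| / (2 * ‖z / ω‖) with hF
  have hdiv : ContinuousAt (fun ω => z / ω) ω₀ := continuousAt_const.div continuousAt_id hω₀
  have hFc : ContinuousAt F ω₀ := by
    refine ContinuousAt.div ?_ (continuousAt_const.mul hdiv.norm) ?_
    · exact (Complex.continuous_re.continuousAt.comp hdiv).max
        (Complex.continuous_im.continuousAt.comp hdiv).abs
    · have : 0 < ‖z / ω₀‖ := norm_pos_iff.2 (div_ne_zero hz0 hω₀)
      positivity
  have hF0 : 0 < F ω₀ := by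
    have : 0 < ‖z / ω₀‖ := norm_pos_iff.2 (div_ne_zero hz0 hω₀)
    have := macdonald_m_pos h
    simp only [hF]
    positivity
  refine ⟨ω₀.re / 2, by positivity, F ω₀ / 2, by positivity, ?_⟩
  filter_upwards [Complex.continuous_re.continuousAt.eventually (lt_mem_nhds (half_lt_self hre)),
    hdiv.eventually (Complex.isOpen_slitPlane.mem_nhds h),
    hFc.eventually (lt_mem_nhds (half_lt_self hF0))] with ω h1 h2 h3
  refine ⟨h1.le, h2, fun s hs => h3.le.trans ?_⟩
  have hω : ω ≠ 0 := by rintro rfl; simp at h2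
  have hζ : z / ω ≠ 0 := div_ne_zero hz0 hω
  rw [rotated_base_eq hω]
  generalize hζe : z / ω = ζ at *
  have : 1 + (s : ℂ) / (2 * ζ) = (2 * ζ + s) / (2 * ζ) := by field_simp
  simp only [hF, hζe]
  rw [this, norm_div, norm_mul, Complex.norm_ofNat]
  have := macdonald_m_le (z := ζ) hs
  gcongr

theorem norm_exp_neg_mul_ofReal (ω : ℂ) (s : ℝ) :
    ‖Complex.exp (-(ω * s))‖ = Real.exp (-(ω.re * s)) := by
  rw [Complex.norm_exp]; simp

theorem rpow_mul_exp_neg_integrable {b m : ℝ} (hb : -1 < b) (hm : 0 < m) :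
    IntegrableOn (fun s : ℝ => s ^ b * Real.exp (-(m * s))) (Ioi 0) := by
  have := integrableOn_rpow_mul_exp_neg_mul_rpow hb one_pos hm
  simpa only [Real.rpow_one, neg_mul] using this

theorem norm_rotatedIntegrand_le {b c m δ : ℝ} (hc : c ≤ 0) (hδ : 0 < δ) {z ω : ℂ} {s : ℝ}
    (hs : 0 < s) (hm : m ≤ ω.re) (h : δ ≤ ‖1 + ω * s / (2 * z)‖) :
    ‖rotatedIntegrand b c z ω s‖ ≤ δ ^ c * (s ^ b * Real.exp (-(m * s))) := by
  rw [rotatedIntegrand, norm_mul, norm_mul, norm_exp_neg_mul_ofReal, Complex.norm_real,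
    Real.norm_of_nonneg (by positivity),
    macdonald_norm_cpow _ (norm_pos_iff.1 (hδ.trans_le h)), mul_comm]
  have := Real.rpow_le_rpow_of_nonpos hδ h hc
  gcongr

theorem rotated_integrable {b c : ℝ} (hb : -1 < b) (hc : c ≤ 0) {z ω : ℂ} (hre : 0 < ω.re)
    (h : z / ω ∈ Complex.slitPlane) : IntegrableOn (rotatedIntegrand b c z ω) (Ioi 0) := by
  obtain ⟨m, hm, δ, hδ, H⟩ := rotated_loc_bound hre h
  have hω : ω ≠ 0 := by rintro rfl; simp at hre
  refine Integrable.mono' ((rpow_mul_exp_neg_integrable hb hm).const_mul (δ ^ c))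
    (rotated_aesm b c hω h) ?_
  filter_upwards [ae_restrict_mem measurableSet_Ioi] with s hs
  exact norm_rotatedIntegrand_le hc hδ hs H.self_of_nhds.1 (H.self_of_nhds.2.2 s (le_of_lt hs))

theorem rotated_differentiableAt {b c : ℝ} (hb : -1 < b) (hc : c ≤ 0) {z ω₀ : ℂ}
    (hre : 0 < ω₀.re) (h : z / ω₀ ∈ Complex.slitPlane) :
    DifferentiableAt ℂ (fun ω => ∫ s in Ioi (0 : ℝ), rotatedIntegrand b c z ω s) ω₀ := by
  obtain ⟨m, hm, δ, hδ, H⟩ := rotated_loc_bound hre h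
  have hω₀ : ω₀ ≠ 0 := by rintro rfl; simp at hre
  have hz0 : z ≠ 0 := by rintro rfl; simp at h
  refine (hasDerivAt_integral_of_dominated_loc_of_deriv_le (s := {ω | _}) H
    (bound := fun s => δ ^ c * (s ^ (b + 1) * Real.exp (-(m * s))) +
      |c| / (2 * ‖z‖) * (δ ^ (c - 1) * (s ^ (b + 1) * Real.exp (-(m * s)))))
    (F' := fun ω s => -rotatedIntegrand (b + 1) c z ω s +
      c / (2 * z) * rotatedIntegrand (b + 1) (c - 1) z ω s)
    ?_ (rotated_integrable hb hc hre h) ?_ ?_ ?_ ?_).2.differentiableAt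
  · filter_upwards [H] with ω hω
    exact rotated_aesm b c (by rintro rfl; simp at hω) hω.2.1
  · exact (rotated_aesm _ _ hω₀ h).neg.add ((rotated_aesm _ _ hω₀ h).const_mul _)
  · filter_upwards [ae_restrict_mem measurableSet_Ioi] with s hs ω hω
    have hs' : (0 : ℝ) < s := hs
    refine (norm_add_le _ _).trans (add_le_add ?_ ?_)
    · rw [norm_neg]
      exact norm_rotatedIntegrand_le hc hδ hs' hω.1 (hω.2.2 s hs'.le)
    · rw [norm_mul, norm_div, norm_mul, Complex.norm_real, Real.norm_eq_abs, Complex.norm_ofNat]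
      have := norm_rotatedIntegrand_le (b := b + 1) (c := c - 1) (by linarith) hδ hs' hω.1
        (hω.2.2 s hs'.le)
      gcongr
  · have := rpow_mul_exp_neg_integrable (b := b + 1) (by linarith) hm
    exact (this.const_mul _).add ((this.const_mul _).const_mul _)
  · filter_upwards [ae_restrict_mem measurableSet_Ioi] with s hs ω hω
    have hs' : (0 : ℝ) < s := hs
    have hω0 : ω ≠ 0 := by rintro rfl; simp at hω
    have h1 : HasDerivAt (fun w : ℂ => 1 + w * s / (2 * z)) (s / (2 * z)) ω := by
      simpa using (((hasDerivAt_id ω).mul_const (s : ℂ)).div_const (2 * z)).const_add 1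
    have h2 : HasDerivAt (fun w : ℂ => Complex.exp (-(w * s)))
        (Complex.exp (-(ω * s)) * (-s)) ω := by
      simpa using (((hasDerivAt_id ω).mul_const (s : ℂ)).neg).cexp
    have h3 := ((h2.const_mul ((s ^ b : ℝ) : ℂ))).mul
      (h1.cpow_const (c := (c : ℂ)) (rotated_base_mem hω0 hω.2.1 hs'.le))
    refine h3.congr_deriv ?_
    simp only [rotatedIntegrand]
    rw [macdonald_rpow_succ b hs']
    push_cast
    ring

theorem rotated_ofReal (b c : ℝ) {z : ℂ} {x : ℝ} (hx : 0 < x) :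
    (x : ℂ) ^ ((b : ℂ) + 1) * ∫ s in Ioi (0 : ℝ), rotatedIntegrand b c z x s =
      macdonaldIntegral b c z := by
  have h := integral_comp_mul_left_Ioi (macdonaldIntegrand b c z) 0 hx
  rw [mul_zero, ← macdonaldIntegral_def] at h
  have e : (∫ s in Ioi (0 : ℝ), macdonaldIntegrand b c z (x * s)) =
      ((x ^ b : ℝ) : ℂ) * ∫ s in Ioi (0 : ℝ), rotatedIntegrand b c z x s := by
    rw [← integral_const_mul]
    refine setIntegral_congr_fun measurableSet_Ioi fun s hs => ?_
    have hs' : (0 : ℝ) < s := hs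
    simp only [macdonaldIntegrand, rotatedIntegrand]
    rw [Real.mul_rpow hx.le hs'.le]
    push_cast
    ring
  rw [e] at h
  have hx0 : (x : ℂ) ≠ 0 := Complex.ofReal_ne_zero.2 hx.ne'
  rw [Complex.cpow_add _ _ hx0, Complex.cpow_one, ← Complex.ofReal_cpow hx.le, mul_right_comm, h,
    Complex.real_smul]
  push_cast
  field_simp

/-- Rotation of the path of integration in `macdonaldIntegral`. -/
theorem macdonaldIntegral_eq_rotated {b c : ℝ} (hb : -1 < b) (hc : c ≤ 0) {z ω : ℂ}
    (hz : 0 < z.im) (hre : 0 < ω.re) (h : z.re * ω.im < z.im * ω.re) :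
    macdonaldIntegral b c z =
      ω ^ ((b : ℂ) + 1) * ∫ s in Ioi (0 : ℝ), rotatedIntegrand b c z ω s := by
  -- The second condition says that `z/ω` stays in the upper half-plane. Both conditions are linear
  -- in `ω`, so `U` is convex, hence connected; it contains `1` because `Im z > 0`.
  set U : Set ℂ := {ω | 0 < ω.re} ∩ {ω | 0 < z.im * ω.re - z.re * ω.im} with hU
  have hUo : IsOpen U := (isOpen_lt continuous_const Complex.continuous_re).inter
    (isOpen_lt continuous_const (by fun_prop))
  have hUc : Convex ℝ U := by
    refine (convex_halfSpace_re_gt 0).inter ?_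
    exact convex_halfSpace_gt (f := fun ω : ℂ => z.im * ω.re - z.re * ω.im)
      ⟨fun x y => by simp; ring, fun a x => by simp; ring⟩ 0
  have hslit : ∀ w ∈ U, z / w ∈ Complex.slitPlane := by
    intro w hw
    have hw0 : w ≠ 0 := by rintro rfl; simpa using hw.1
    have hn : 0 < Complex.normSq w := Complex.normSq_pos.2 hw0
    rw [Complex.mem_slitPlane_iff]
    right
    have h2 : 0 < z.im * w.re - z.re * w.im := hw.2
    rw [Complex.div_im, ← sub_div]
    exact (div_pos h2 hn).ne'
  set G : ℂ → ℂ := fun w => w ^ ((b : ℂ) + 1) * ∫ s in Ioi (0 : ℝ), rotatedIntegrand b c z w s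
  have hG : AnalyticOnNhd ℂ G U := by
    refine DifferentiableOn.analyticOnNhd (fun w hw => ?_) hUo
    have hw1 : 0 < w.re := hw.1
    exact ((differentiableAt_id.cpow_const (Or.inl hw1)).mul
      (rotated_differentiableAt hb hc hw1 (hslit w hw))).differentiableWithinAt
  have h1 : (1 : ℂ) ∈ U := ⟨by simp, by simpa using hz⟩
  -- For real `w > 0` the equality is a linear change of variable. These points accumulate at `1`,
  -- so the identity theorem extends it to `U`.
  have hfreq : ∃ᶠ w in 𝓝[≠] (1 : ℂ), G w = macdonaldIntegral b c z := by
    have ht : Tendsto (fun x : ℝ => (x : ℂ)) (𝓝[≠] 1) (𝓝[≠] 1) := by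
      refine tendsto_nhdsWithin_iff.2 ⟨?_, ?_⟩
      · exact (Complex.continuous_ofReal.tendsto' 1 1 (by simp)).mono_left nhdsWithin_le_nhds
      · filter_upwards [self_mem_nhdsWithin] with x hx
        simpa using hx
    refine ht.frequently (Eventually.frequently ?_)
    filter_upwards [mem_nhdsWithin_of_mem_nhds (lt_mem_nhds one_pos)] with x hx
    exact rotated_ofReal b c hx
  have := hG.eqOn_of_preconnected_of_frequently_eq analyticOnNhd_const hUc.isPreconnected h1 hfreq
    (x := ω) ⟨hre, by simpa using h⟩
  exact this.symm

/-! ### Expansion of the inverse square root away from the negative axis -/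

theorem norm_one_add_sq (x : ℂ) : ‖1 + x‖ ^ 2 = 1 + 2 * x.re + ‖x‖ ^ 2 := by
  rw [← Complex.normSq_eq_norm_sq, ← Complex.normSq_eq_norm_sq, Complex.normSq_apply,
    Complex.normSq_apply]
  simp; ring

/-- The hypothesis keeps `x` at an angle with cosine at most `4/5` from the negative axis, and `3/5`
is the corresponding sine. With `q = |x|`, `1 - 8q/5 + q²` equals both `9/25 + (q - 4/5)²` and
`9q²/25 + (1 - 4q/5)²`. -/
theorem norm_one_add_ge {x : ℂ} (hx : -(4 / 5) * ‖x‖ ≤ x.re) :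
    3 / 5 * max 1 ‖x‖ ≤ ‖1 + x‖ := by
  have h := norm_one_add_sq x
  have hn := norm_nonneg x
  rw [mul_max_of_nonneg _ _ (by norm_num)]
  refine max_le ?_ ?_
  · refine le_of_sq_le_sq ?_ (norm_nonneg _)
    nlinarith [sq_nonneg (‖x‖ - 4 / 5)]
  · refine le_of_sq_le_sq ?_ (norm_nonneg _)
    nlinarith [sq_nonneg (1 - 4 / 5 * ‖x‖)]

/-- The real-variable core of `sqrt_bounds`, with `q = |x|`, `y = Re x`, `ρ = |u|²`, `a = Re u`; the
two conclusions bound the squares of `|u||1+u|` and `|1+u|`. -/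
theorem sqrt_bounds_aux {q ρ a y : ℝ} (hρ0 : 0 ≤ ρ) (ha0 : 0 ≤ a)
    (hy : -(4 / 5) * q ≤ y) (h2 : ρ ^ 2 = 1 + 2 * y + q ^ 2) (h4 : 2 * a ^ 2 = ρ + 1 + y)
    (h5 : 3 / 5 * 1 ≤ ρ) :
    169 / 100 ≤ ρ * (1 + 2 * a + ρ) ∧ 9 / 4 ≤ 1 + 2 * a + ρ := by
  have h2' : 9 / 25 + (q - 4 / 5) ^ 2 ≤ ρ ^ 2 := by linarith
  suffices h : ∃ p d : ℝ, 0 ≤ p ∧ 0 ≤ d ∧ p ≤ ρ ∧ d ^ 2 ≤ a ^ 2 ∧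
      169 / 100 ≤ p * (1 + 2 * d + p) ∧ 9 / 4 ≤ 1 + 2 * d + p by
    obtain ⟨p, d, hp, hd, h6, h7, h8, h9⟩ := h
    have h10 : d ≤ a := le_of_sq_le_sq h7 ha0
    exact ⟨h8.trans (by gcongr), h9.trans (by gcongr)⟩
  -- In each range `p` and `d` are rounded lower bounds for `ρ` and `a`. A small `q` limits how
  -- negative `y` can be, while a large `q` forces `ρ` up. The first two ranges leave little slack
  -- over `1.69`.
  rcases le_total q (107 / 100) with c1 | c1
  · exact ⟨3 / 5, 609 / 1000, by norm_num, by norm_num, by linarith, by linarith,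
      by norm_num, by norm_num⟩
  · rcases le_total q (155 / 100) with c2 | c2
    · have hρ : 6579 / 10000 ≤ ρ := by
        refine le_of_sq_le_sq ?_ hρ0
        have : (27 / 100 : ℝ) ^ 2 ≤ (q - 4 / 5) ^ 2 := by gcongr; linarith
        linarith
      exact ⟨6579 / 10000, 457 / 1000, by norm_num, by norm_num, hρ, by linarith,
        by norm_num, by norm_num⟩
    · have hρ : q - 4 / 5 ≤ ρ := le_of_sq_le_sq (by linarith) hρ0
      have hρ' : 96 / 100 ≤ ρ := by
        refine le_of_sq_le_sq ?_ hρ0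
        have : (75 / 100 : ℝ) ^ 2 ≤ (q - 4 / 5) ^ 2 := by gcongr; linarith
        linarith
      exact ⟨96 / 100, 1 / 2, by norm_num, by norm_num, hρ', by linarith,
        by norm_num, by norm_num⟩

theorem sqrt_bounds {x u : ℂ} (hx : -(4 / 5) * ‖x‖ ≤ x.re) (hu : u ^ 2 = 1 + x) (hre : 0 ≤ u.re) :
    13 / 10 ≤ ‖u‖ * ‖1 + u‖ ∧ 3 / 2 ≤ ‖1 + u‖ := by
  have h1 : ‖u‖ ^ 2 = ‖1 + x‖ := by rw [← norm_pow, hu]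
  have h2 := norm_one_add_sq x
  have h3 := norm_one_add_sq u
  have h4 : 2 * u.re ^ 2 = ‖u‖ ^ 2 + 1 + x.re := by
    have := congrArg Complex.re hu
    rw [pow_two, Complex.mul_re, Complex.add_re, Complex.one_re] at this
    rw [← Complex.normSq_eq_norm_sq, Complex.normSq_apply]
    linarith
  have h5 := norm_one_add_ge hx
  rw [mul_max_of_nonneg _ _ (by norm_num), max_le_iff] at h5
  rw [← h1] at h2 h5
  set ρ := ‖u‖ ^ 2
  set q := ‖x‖
  set a := u.re
  have hρ0 : 0 ≤ ρ := by positivity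
  have key := sqrt_bounds_aux hρ0 hre hx (by linarith) h4 h5.1
  rw [← h3] at key
  constructor
  · refine le_of_sq_le_sq ?_ (by positivity)
    rw [mul_pow]
    linarith [key.1]
  · refine le_of_sq_le_sq ?_ (norm_nonneg _)
    linarith [key.2]

/-- With `u = √(1+x)` the remainders are exactly `-x/(u(1+u))` and `x²(2+u)/(2u(1+u)²)`, so
`sqrt_bounds` gives explicit constants; `25/39` is `(5/3)/(2·13/10)`. -/
theorem inv_sqrt_expansion {x : ℂ} (hx : -(4 / 5) * ‖x‖ ≤ x.re) :
    ‖(1 + x) ^ ((-(1 / 2) : ℝ) : ℂ) - 1‖ ≤ 10 / 13 * ‖x‖ ∧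
    ‖(1 + x) ^ ((-(1 / 2) : ℝ) : ℂ) - 1 + x / 2‖ ≤ 25 / 39 * ‖x‖ ^ 2 := by
  have hw : 0 < ‖1 + x‖ := lt_of_lt_of_le (by positivity) (norm_one_add_ge hx)
  have hw0 : 1 + x ≠ 0 := norm_pos_iff.1 hw
  set u : ℂ := (1 + x) ^ (2⁻¹ : ℂ) with hu
  have hsq : u ^ 2 = 1 + x := by
    rw [hu, ← Complex.cpow_ofNat, ← Complex.cpow_ofNat_inv_pow (1 + x) 2]; simp
  have hre : 0 ≤ u.re := by
    have e : (2⁻¹ : ℂ) = ((2⁻¹ : ℝ) : ℂ) := by norm_num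
    rw [hu, e, Complex.cpow_ofReal_re]
    refine mul_nonneg (by positivity) (Real.cos_nonneg_of_mem_Icc ⟨?_, ?_⟩)
    · have := Complex.neg_pi_lt_arg (1 + x); linarith
    · have := Complex.arg_le_pi (1 + x); linarith
  obtain ⟨b1, b2⟩ := sqrt_bounds hx hsq hre
  have hinv : (1 + x) ^ ((-(1 / 2) : ℝ) : ℂ) = u⁻¹ := by
    rw [hu, ← Complex.cpow_neg]; norm_num
  have hu0 : u ≠ 0 := by
    intro h; rw [h] at hsq; simp at hsq; exact hw0 hsq.symm
  have hu1 : 1 + u ≠ 0 := norm_pos_iff.1 (by linarith)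
  have hxe : x = (u - 1) * (1 + u) := by linear_combination -hsq
  have hup : 0 < ‖u‖ := norm_pos_iff.2 hu0
  have hu1p : 0 < ‖1 + u‖ := by linarith
  rw [hinv]
  constructor
  · have e : u⁻¹ - 1 = -(x / (u * (1 + u))) := by rw [hxe]; field_simp; ring
    rw [e, norm_neg, norm_div, norm_mul, div_le_iff₀ (by positivity)]
    nlinarith [norm_nonneg x]
  · have e : u⁻¹ - 1 + x / 2 = x ^ 2 * ((1 + u) + 1) / (2 * (u * (1 + u)) * (1 + u)) := by
      rw [hxe]; field_simp; ring
    rw [e, norm_div, norm_mul, norm_mul, norm_mul, norm_mul, norm_pow, Complex.norm_ofNat,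
      div_le_iff₀ (by positivity)]
    have h6 : ‖1 + u + 1‖ ≤ 5 / 3 * ‖1 + u‖ := by
      refine (norm_add_le _ _).trans ?_
      rw [norm_one]; linarith
    calc ‖x‖ ^ 2 * ‖1 + u + 1‖ ≤ ‖x‖ ^ 2 * (5 / 3 * ‖1 + u‖) := by gcongr
      _ = 25 / 39 * ‖x‖ ^ 2 * (2 * (13 / 10) * ‖1 + u‖) := by ring
      _ ≤ _ := by gcongr

/-! ### The sharp exponential bound for `μ = 0` in the second quadrant -/

/-- The direction `(4 + 3i)/5` of the rotated path. -/
noncomputable def rotationDir : ℂ := ⟨4 / 5, 3 / 5⟩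

theorem norm_rotationDir : ‖rotationDir‖ = 1 := by
  rw [← sq_eq_sq₀ (norm_nonneg _) zero_le_one, ← Complex.normSq_eq_norm_sq, Complex.normSq_apply]
  norm_num [rotationDir]

theorem norm_rotated_arg (z : ℂ) {s : ℝ} (hs : 0 ≤ s) :
    ‖rotationDir * s / (2 * z)‖ = s / (2 * ‖z‖) := by
  simp [norm_rotationDir, abs_of_nonneg hs]

/-- `Re(ω/z)` is `(4/5 Re z + 3/5 Im z)/|z|²` for `ω = rotationDir`; the second term is positive and
`Re z ≥ -|z|`. The price of the rotation is that `e^{-s}` weakens to `e^{-4s/5}`. -/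
theorem re_rotated_arg {z : ℂ} (him : 0 < z.im) {s : ℝ} (hs : 0 ≤ s) :
    -(4 / 5) * ‖rotationDir * s / (2 * z)‖ ≤ (rotationDir * s / (2 * z)).re := by
  rw [norm_rotated_arg z hs]
  have hz0 : z ≠ 0 := by rintro rfl; simp at him
  have hr : 0 < ‖z‖ := norm_pos_iff.2 hz0
  have e : (rotationDir * s / (2 * z)).re =
      s / (2 * ‖z‖ ^ 2) * (4 / 5 * z.re + 3 / 5 * z.im) := by
    rw [show rotationDir * s / (2 * z) = ((s / 2 : ℝ) : ℂ) * (rotationDir / z) by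
      push_cast; field_simp, Complex.re_ofReal_mul, Complex.div_re, ← Complex.normSq_eq_norm_sq]
    simp only [rotationDir]
    have := Complex.normSq_pos.2 hz0
    field_simp
  have h1 := (abs_le.1 (Complex.abs_re_le_norm z)).1
  rw [e]
  calc -(4 / 5) * (s / (2 * ‖z‖)) = s / (2 * ‖z‖ ^ 2) * (-(4 / 5) * ‖z‖) := by field_simp
    _ ≤ _ := by gcongr; linarith

theorem macdonaldIntegral_eq_rotationDir {b c : ℝ} (hb : -1 < b) (hc : c ≤ 0) {z : ℂ}
    (him : 0 < z.im) (hre : z.re ≤ 0) :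
    macdonaldIntegral b c z =
      rotationDir ^ ((b : ℂ) + 1) * ∫ s in Ioi (0 : ℝ), rotatedIntegrand b c z rotationDir s :=
  macdonaldIntegral_eq_rotated hb hc him (by norm_num [rotationDir])
    (by simp only [rotationDir]; nlinarith)

theorem rotationDir_div_mem {z : ℂ} (him : 0 < z.im) (hre : z.re ≤ 0) :
    z / rotationDir ∈ Complex.slitPlane := by
  have hw0 : rotationDir ≠ 0 := norm_pos_iff.1 (by rw [norm_rotationDir]; exact one_pos)
  have hn : 0 < Complex.normSq rotationDir := Complex.normSq_pos.2 hw0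
  rw [Complex.mem_slitPlane_iff]
  right
  rw [Complex.div_im, ← sub_div]
  refine (div_pos ?_ hn).ne'
  simp only [rotationDir]
  nlinarith

theorem norm_rotationDir_cpow (b : ℝ) : ‖rotationDir ^ ((b : ℂ) + 1)‖ = 1 := by
  have hw0 : rotationDir ≠ 0 := norm_pos_iff.1 (by rw [norm_rotationDir]; exact one_pos)
  have := macdonald_norm_cpow (b + 1) hw0
  push_cast at this
  rw [this, norm_rotationDir, Real.one_rpow]

theorem rpow_mul_exp_neg_integral {b m : ℝ} (hb : -1 < b) (hm : 0 < m) :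
    ∫ s in Ioi (0 : ℝ), s ^ b * Real.exp (-(m * s)) =
      (1 / m) ^ (b + 1) * Real.Gamma (b + 1) := by
  have := Real.integral_rpow_mul_exp_neg_mul_Ioi (a := b + 1) (r := m) (by linarith) hm
  simpa using this

theorem macdonaldIntegral_zero_right {b : ℝ} (hb : -1 < b) (z : ℂ) :
    macdonaldIntegral b 0 z = (Real.Gamma (b + 1) : ℂ) := by
  have h := rpow_mul_exp_neg_integral hb one_pos
  rw [div_one, Real.one_rpow, one_mul] at h
  rw [← h, ← integral_complex_ofReal, macdonaldIntegral]
  refine setIntegral_congr_fun measurableSet_Ioi fun t _ => ?_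
  simp [macdonaldIntegrand]; ring

/-- `Γ(1/2)` is the same integral with inner exponent `0`, so it can be rotated onto the same ray
and subtracted under the integral sign before the first-order expansion is applied. -/
theorem norm_sub_gamma_le {z : ℂ} (him : 0 < z.im) (hre : z.re ≤ 0) :
    ‖macdonaldIntegral (-(1 / 2)) (-(1 / 2)) z - Real.Gamma (1 / 2)‖ ≤
      5 / (13 * ‖z‖) * ((5 / 4) ^ (3 / 2 : ℝ) * Real.Gamma (3 / 2)) := by
  have hz0 : z ≠ 0 := by rintro rfl; simp at him
  have hr : 0 < ‖z‖ := norm_pos_iff.2 hz0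
  have hd : 0 < rotationDir.re := by norm_num [rotationDir]
  have hs := rotationDir_div_mem him hre
  have e0 := macdonaldIntegral_zero_right (b := -(1 / 2)) (by norm_num) z
  rw [show (-(1 / 2) + 1 : ℝ) = 1 / 2 by norm_num] at e0
  rw [← e0, macdonaldIntegral_eq_rotationDir (by norm_num) (by norm_num) him hre,
    macdonaldIntegral_eq_rotationDir (by norm_num) le_rfl him hre, ← mul_sub,
    ← integral_sub (rotated_integrable (by norm_num) (by norm_num) hd hs)
      (rotated_integrable (by norm_num) le_rfl hd hs), norm_mul, norm_rotationDir_cpow, one_mul]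
  have hI := rpow_mul_exp_neg_integral (b := 1 / 2) (m := 4 / 5) (by norm_num) (by norm_num)
  norm_num at hI
  rw [← hI, ← integral_const_mul]
  refine norm_integral_le_of_norm_le ?_ ?_
  · exact (rpow_mul_exp_neg_integrable (by norm_num) (by norm_num)).const_mul _
  · filter_upwards [ae_restrict_mem measurableSet_Ioi] with s hs
    have hs' : (0 : ℝ) < s := hs
    have h1 := (inv_sqrt_expansion (re_rotated_arg him hs'.le)).1
    rw [norm_rotated_arg z hs'.le] at h1
    have e : rotatedIntegrand (-(1 / 2)) (-(1 / 2)) z rotationDir s -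
        rotatedIntegrand (-(1 / 2)) 0 z rotationDir s =
        ((s ^ (-(1 / 2) : ℝ) : ℝ) : ℂ) * Complex.exp (-(rotationDir * s)) *
        ((1 + rotationDir * s / (2 * z)) ^ ((-(1 / 2) : ℝ) : ℂ) - 1) := by
      simp only [rotatedIntegrand, Complex.ofReal_zero, Complex.cpow_zero]; ring
    have e2 : s ^ (1 / 2 : ℝ) = s ^ (-(1 / 2) : ℝ) * s := by
      rw [← macdonald_rpow_succ _ hs']; norm_num
    rw [e, norm_mul, norm_mul, norm_exp_neg_mul_ofReal, Complex.norm_real,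
      Real.norm_of_nonneg (by positivity), e2]
    calc _ ≤ s ^ (-(1 / 2) : ℝ) * Real.exp (-(rotationDir.re * s)) *
        (10 / 13 * (s / (2 * ‖z‖))) := by gcongr
      _ = _ := by simp only [rotationDir]; field_simp; norm_num

/-- The second-order analogue of `norm_sub_gamma_le`. It is needed for large `|z|`, where the bound
obtained from the first-order remainder has a linear coefficient slightly above the admissible one.
-/
theorem norm_sub_gamma_add_le {z : ℂ} (him : 0 < z.im) (hre : z.re ≤ 0) :
    ‖macdonaldIntegral (-(1 / 2)) (-(1 / 2)) z - Real.Gamma (1 / 2)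
        + 1 / (4 * z) * Real.Gamma (3 / 2)‖ ≤
      25 / (156 * ‖z‖ ^ 2) * ((5 / 4) ^ (5 / 2 : ℝ) * Real.Gamma (5 / 2)) := by
  have hz0 : z ≠ 0 := by rintro rfl; simp at him
  have hr : 0 < ‖z‖ := norm_pos_iff.2 hz0
  have hd : 0 < rotationDir.re := by norm_num [rotationDir]
  have hd0 : rotationDir ≠ 0 := by intro h; rw [h] at hd; simp at hd
  have hs := rotationDir_div_mem him hre
  have e0 := macdonaldIntegral_zero_right (b := -(1 / 2)) (by norm_num) z
  rw [show (-(1 / 2) + 1 : ℝ) = 1 / 2 by norm_num] at e0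
  have e1 := macdonaldIntegral_zero_right (b := 1 / 2) (by norm_num) z
  rw [show (1 / 2 + 1 : ℝ) = 3 / 2 by norm_num] at e1
  have hp : rotationDir ^ (((1 / 2 : ℝ) : ℂ) + 1) =
      rotationDir ^ (((-(1 / 2) : ℝ) : ℂ) + 1) * rotationDir := by
    have : (((1 / 2 : ℝ) : ℂ) + 1) = (((-(1 / 2) : ℝ) : ℂ) + 1) + 1 := by push_cast; ring
    rw [this, Complex.cpow_add _ _ hd0, Complex.cpow_one]
  have i1 := rotated_integrable (b := -(1 / 2)) (c := -(1 / 2)) (by norm_num) (by norm_num) hd hs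
  have i2 := rotated_integrable (b := -(1 / 2)) (c := 0) (by norm_num) le_rfl hd hs
  have i3 := (rotated_integrable (b := 1 / 2) (c := 0) (by norm_num) le_rfl hd hs).const_mul
    (rotationDir / (4 * z))
  have hA : macdonaldIntegral (-(1 / 2)) (-(1 / 2)) z - Real.Gamma (1 / 2)
        + 1 / (4 * z) * Real.Gamma (3 / 2) = rotationDir ^ (((-(1 / 2) : ℝ) : ℂ) + 1) *
      ∫ s in Ioi (0 : ℝ), (rotatedIntegrand (-(1 / 2)) (-(1 / 2)) z rotationDir s -
        rotatedIntegrand (-(1 / 2)) 0 z rotationDir s +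
        rotationDir / (4 * z) * rotatedIntegrand (1 / 2) 0 z rotationDir s) := by
    have k1 := integral_add (i1.sub i2) i3
    have k2 := integral_sub i1 i2
    simp only [Pi.sub_apply] at k1 k2
    rw [k1, k2, integral_const_mul, ← e0, ← e1,
      macdonaldIntegral_eq_rotationDir (by norm_num) (by norm_num) him hre,
      macdonaldIntegral_eq_rotationDir (by norm_num) le_rfl him hre,
      macdonaldIntegral_eq_rotationDir (b := 1 / 2) (by norm_num) le_rfl him hre, hp]
    ring
  rw [hA, norm_mul, norm_rotationDir_cpow, one_mul]
  have hI := rpow_mul_exp_neg_integral (b := 3 / 2) (m := 4 / 5) (by norm_num) (by norm_num)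
  norm_num at hI
  rw [← hI, ← integral_const_mul]
  refine norm_integral_le_of_norm_le ?_ ?_
  · exact (rpow_mul_exp_neg_integrable (by norm_num) (by norm_num)).const_mul _
  · filter_upwards [ae_restrict_mem measurableSet_Ioi] with s hs
    have hs' : (0 : ℝ) < s := hs
    have h1 := (inv_sqrt_expansion (re_rotated_arg him hs'.le)).2
    rw [norm_rotated_arg z hs'.le] at h1
    have e2 : s ^ (1 / 2 : ℝ) = s ^ (-(1 / 2) : ℝ) * s := by
      rw [← macdonald_rpow_succ _ hs']; norm_num
    have e3 : s ^ (3 / 2 : ℝ) = s ^ (-(1 / 2) : ℝ) * s * s := by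
      rw [← macdonald_rpow_succ _ hs', ← macdonald_rpow_succ _ hs']; norm_num
    have e : rotatedIntegrand (-(1 / 2)) (-(1 / 2)) z rotationDir s -
        rotatedIntegrand (-(1 / 2)) 0 z rotationDir s +
        rotationDir / (4 * z) * rotatedIntegrand (1 / 2) 0 z rotationDir s =
        ((s ^ (-(1 / 2) : ℝ) : ℝ) : ℂ) * Complex.exp (-(rotationDir * s)) *
        ((1 + rotationDir * s / (2 * z)) ^ ((-(1 / 2) : ℝ) : ℂ) - 1
          + rotationDir * s / (2 * z) / 2) := by
      simp only [rotatedIntegrand, Complex.ofReal_zero, Complex.cpow_zero, e2]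
      push_cast
      field_simp
      ring
    rw [e, norm_mul, norm_mul, norm_exp_neg_mul_ofReal, Complex.norm_real,
      Real.norm_of_nonneg (by positivity), e3]
    calc _ ≤ s ^ (-(1 / 2) : ℝ) * Real.exp (-(rotationDir.re * s)) *
        (25 / 39 * (s / (2 * ‖z‖)) ^ 2) := by gcongr
      _ = _ := by simp only [rotationDir]; field_simp; norm_num

theorem gamma_three_halves : Real.Gamma (3 / 2) = 1 / 2 * Real.Gamma (1 / 2) := by
  rw [← Real.Gamma_add_one (by norm_num)]; norm_num

theorem gamma_five_halves : Real.Gamma (5 / 2) = 3 / 4 * Real.Gamma (1 / 2) := by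
  have := Real.Gamma_add_one (s := 3 / 2) (by norm_num)
  rw [gamma_three_halves] at this
  rw [show (5 / 2 : ℝ) = 3 / 2 + 1 by norm_num, this]; ring

theorem five_fourths_rpow_le : (5 / 4 : ℝ) ^ (3 / 2 : ℝ) ≤ 1.398 := by
  refine le_of_sq_le_sq ?_ (by norm_num)
  rw [← Real.rpow_natCast, ← Real.rpow_mul (by norm_num)]
  norm_num

theorem norm_le_exp_of_im_pos {z : ℂ} (him : 0 < z.im) (hre : z.re ≤ 0) :
    ‖macdonaldIntegral (-(1 / 2)) (-(1 / 2)) z‖ ≤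
      Real.Gamma (1 / 2) * Real.exp (1 / 4 / ‖z‖) := by
  have hz0 : z ≠ 0 := by rintro rfl; simp at him
  have hr : 0 < ‖z‖ := norm_pos_iff.2 hz0
  have hΓ : 0 < Real.Gamma (1 / 2) := Real.Gamma_pos_of_pos (by norm_num)
  have hexp := Real.quadratic_le_exp_of_nonneg (x := 1 / 4 / ‖z‖) (by positivity)
  have h54 := five_fourths_rpow_le
  have hnΓ : ‖(Real.Gamma (1 / 2) : ℂ)‖ = Real.Gamma (1 / 2) := by
    rw [Complex.norm_real, Real.norm_of_nonneg hΓ.le]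
  set y := 1 / 4 / ‖z‖ with hy
  have hyp : 0 < y := by positivity
  have hzy : 1 / ‖z‖ = 4 * y := by rw [hy]; ring
  suffices h : ‖macdonaldIntegral (-(1 / 2)) (-(1 / 2)) z‖ ≤
      Real.Gamma (1 / 2) * (1 + y + y ^ 2 / 2) from h.trans (by gcongr)
  -- Dividing by `Γ(1/2)`, the first-order estimate gives about `1 + 1.076 y`, which suffices for
  -- `y` above about `0.151`. The second-order one gives about `1 + y/2 + 3.37 y²`, which suffices
  -- for `y` below about `0.174`. The value `1/6` lies between.
  rcases le_total (1 / 6) y with hc | hc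
  · have h := norm_sub_gamma_le him hre
    have h2 := norm_sub_norm_le (macdonaldIntegral (-(1 / 2)) (-(1 / 2)) z)
      (Real.Gamma (1 / 2) : ℂ)
    rw [hnΓ] at h2
    have e : 5 / (13 * ‖z‖) * ((5 / 4 : ℝ) ^ (3 / 2 : ℝ) * Real.Gamma (3 / 2)) =
        Real.Gamma (1 / 2) * (10 / 13 * y * (5 / 4 : ℝ) ^ (3 / 2 : ℝ)) := by
      rw [gamma_three_halves, show 5 / (13 * ‖z‖) = 5 / 13 * (1 / ‖z‖) by field_simp, hzy]; ring
    have h3 : 10 / 13 * y * (5 / 4 : ℝ) ^ (3 / 2 : ℝ) ≤ y + y ^ 2 / 2 := by nlinarith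
    have h4 := mul_le_mul_of_nonneg_left h3 hΓ.le
    rw [← e] at h4
    linarith
  · have h := norm_sub_gamma_add_le him hre
    have h2 : ‖macdonaldIntegral (-(1 / 2)) (-(1 / 2)) z‖ ≤
        ‖macdonaldIntegral (-(1 / 2)) (-(1 / 2)) z - Real.Gamma (1 / 2)
        + 1 / (4 * z) * Real.Gamma (3 / 2)‖ + ‖(Real.Gamma (1 / 2) : ℂ)‖ +
        ‖1 / (4 * z) * (Real.Gamma (3 / 2) : ℂ)‖ := by
      have := norm_sub_le (macdonaldIntegral (-(1 / 2)) (-(1 / 2)) z - Real.Gamma (1 / 2)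
        + 1 / (4 * z) * Real.Gamma (3 / 2) + (Real.Gamma (1 / 2) : ℂ))
        (1 / (4 * z) * (Real.Gamma (3 / 2) : ℂ))
      rw [show macdonaldIntegral (-(1 / 2)) (-(1 / 2)) z - (Real.Gamma (1 / 2) : ℂ)
        + 1 / (4 * z) * Real.Gamma (3 / 2) + (Real.Gamma (1 / 2) : ℂ) -
        1 / (4 * z) * (Real.Gamma (3 / 2) : ℂ) =
        macdonaldIntegral (-(1 / 2)) (-(1 / 2)) z by ring] at this
      exact this.trans (add_le_add_left (norm_add_le _ _) _)
    have e3 : ‖1 / (4 * z) * (Real.Gamma (3 / 2) : ℂ)‖ = Real.Gamma (1 / 2) * (y / 2) := by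
      rw [gamma_three_halves, norm_mul, norm_div, norm_mul, Complex.norm_real,
        Real.norm_of_nonneg (by positivity), norm_one, Complex.norm_ofNat, hy]
      field_simp
    have e52 : (5 / 4 : ℝ) ^ (5 / 2 : ℝ) = (5 / 4 : ℝ) ^ (3 / 2 : ℝ) * (5 / 4) := by
      rw [← macdonald_rpow_succ _ (by norm_num)]; norm_num
    have e : 25 / (156 * ‖z‖ ^ 2) * ((5 / 4 : ℝ) ^ (5 / 2 : ℝ) * Real.Gamma (5 / 2)) =
        Real.Gamma (1 / 2) * (125 / 52 * y ^ 2 * (5 / 4 : ℝ) ^ (3 / 2 : ℝ)) := by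
      rw [gamma_five_halves, e52,
        show 25 / (156 * ‖z‖ ^ 2) = 25 / 156 * (1 / ‖z‖) ^ 2 by field_simp, hzy]; ring
    have h3 : 125 / 52 * y ^ 2 * (5 / 4 : ℝ) ^ (3 / 2 : ℝ) + y / 2 ≤ y + y ^ 2 / 2 := by
      have : 125 / 52 * y ^ 2 * (5 / 4 : ℝ) ^ (3 / 2 : ℝ) ≤ 125 / 52 * y ^ 2 * 1.398 := by gcongr
      nlinarith
    have h4 := mul_le_mul_of_nonneg_left h3 hΓ.le
    rw [mul_add, ← e] at h4
    rw [hnΓ, e3] at h2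
    linarith

/-! ### Bounds on the whole slit plane for nonpositive inner exponent -/

theorem macdonaldIntegral_conj (b c : ℝ) {z : ℂ} (hz : z ∈ Complex.slitPlane) :
    macdonaldIntegral b c ((starRingEnd ℂ) z) = (starRingEnd ℂ) (macdonaldIntegral b c z) := by
  rw [macdonaldIntegral, macdonaldIntegral, ← integral_conj]
  refine setIntegral_congr_fun measurableSet_Ioi fun t ht => ?_
  have hm := macdonald_base_mem hz (le_of_lt ht)
  have e : 1 + (t : ℂ) / (2 * (starRingEnd ℂ) z) = (starRingEnd ℂ) (1 + (t : ℂ) / (2 * z)) := by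
    have h2 : (starRingEnd ℂ) 2 = 2 := map_ofNat _ 2
    simp [h2]
  simp only [macdonaldIntegrand, map_mul, Complex.conj_ofReal]
  rw [e, Complex.conj_cpow _ _ (Complex.slitPlane_arg_ne_pi hm), Complex.conj_ofReal]

/-- No rotation is needed here: `x = s/(2z)` has nonnegative real part, so `|1+x|` is at least both
`1` and `|x|`. Allowing any decay rate `m ≤ 1` lets the same majorant serve the rotated case with `m
= 4/5`. -/
theorem norm_macdonaldIntegral_le_of_re_nonneg {b c : ℝ} {z : ℂ} (hz : z ∈ Complex.slitPlane)
    (hre : 0 ≤ z.re) (hc : c ≤ 0) {K : ℝ → ℝ} {m : ℝ} (hm : m ≤ 1)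
    (hK : IntegrableOn (fun s : ℝ => s ^ b * Real.exp (-(m * s)) * K s) (Ioi 0))
    (hKc : ∀ s : ℝ, 0 < s → max 1 (s / (2 * ‖z‖)) ^ c ≤ K s) :
    ‖macdonaldIntegral b c z‖ ≤ ∫ s in Ioi (0 : ℝ), s ^ b * Real.exp (-(m * s)) * K s := by
  have hz0 := Complex.slitPlane_ne_zero hz
  have hr : 0 < ‖z‖ := norm_pos_iff.2 hz0
  refine norm_integral_le_of_norm_le hK ?_
  filter_upwards [ae_restrict_mem measurableSet_Ioi] with s hs
  have hs' : (0 : ℝ) < s := hs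
  have hx : ‖(s : ℂ) / (2 * z)‖ = s / (2 * ‖z‖) := by simp [abs_of_pos hs']
  have hxre : 0 ≤ ((s : ℂ) / (2 * z)).re := by
    rw [show (s : ℂ) / (2 * z) = ((s / 2 : ℝ) : ℂ) * z⁻¹ by push_cast; field_simp,
      Complex.re_ofReal_mul, Complex.inv_re]
    have := Complex.normSq_nonneg z
    positivity
  have hmax : max 1 (s / (2 * ‖z‖)) ≤ ‖1 + (s : ℂ) / (2 * z)‖ := by
    have h := norm_one_add_sq ((s : ℂ) / (2 * z))
    rw [hx] at h
    have hq : 0 ≤ s / (2 * ‖z‖) := by positivity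
    refine max_le ?_ ?_ <;> refine le_of_sq_le_sq ?_ (norm_nonneg _) <;> nlinarith
  rw [macdonaldIntegrand, norm_mul, Complex.norm_real, Real.norm_of_nonneg (by positivity),
    macdonald_norm_cpow _ (Complex.slitPlane_ne_zero (macdonald_base_mem hz hs'.le))]
  have h1 : ‖1 + (s : ℂ) / (2 * z)‖ ^ c ≤ K s :=
    (Real.rpow_le_rpow_of_nonpos (by positivity) hmax hc).trans (hKc s hs')
  rw [mul_comm (Real.exp (-s))]
  gcongr
  nlinarith

theorem norm_macdonaldIntegral_le_of_im_pos {b c : ℝ} (hb : -1 < b) {z : ℂ}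
    (him : 0 < z.im) (hre : z.re ≤ 0) (hc : c ≤ 0) {K : ℝ → ℝ}
    (hK : IntegrableOn (fun s : ℝ => s ^ b * Real.exp (-(4 / 5 * s)) * K s) (Ioi 0))
    (hKc : ∀ s : ℝ, 0 < s → (3 / 5 * max 1 (s / (2 * ‖z‖))) ^ c ≤ K s) :
    ‖macdonaldIntegral b c z‖ ≤ ∫ s in Ioi (0 : ℝ), s ^ b * Real.exp (-(4 / 5 * s)) * K s := by
  rw [macdonaldIntegral_eq_rotationDir hb hc him hre, norm_mul, norm_rotationDir_cpow, one_mul]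
  refine norm_integral_le_of_norm_le hK ?_
  filter_upwards [ae_restrict_mem measurableSet_Ioi] with s hs
  have hs' : (0 : ℝ) < s := hs
  have hmax := norm_one_add_ge (re_rotated_arg him hs'.le)
  rw [norm_rotated_arg z hs'.le] at hmax
  have hpos : 0 < 3 / 5 * max 1 (s / (2 * ‖z‖)) := by positivity
  rw [rotatedIntegrand, norm_mul, norm_mul, norm_exp_neg_mul_ofReal, Complex.norm_real,
    Real.norm_of_nonneg (by positivity), macdonald_norm_cpow _ (norm_pos_iff.1 (hpos.trans_le hmax))]
  have h1 := (Real.rpow_le_rpow_of_nonpos hpos hmax hc).trans (hKc s hs')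
  have e : rotationDir.re = 4 / 5 := rfl
  rw [e]
  gcongr

/-- A reduction of bounds on the slit plane to the right half-plane and the second quadrant. -/
theorem norm_macdonaldIntegral_le_cases {b c B : ℝ} {z : ℂ} (hz : z ∈ Complex.slitPlane)
    (h1 : 0 ≤ z.re → ‖macdonaldIntegral b c z‖ ≤ B)
    (h2 : ∀ w ∈ Complex.slitPlane, ‖w‖ = ‖z‖ → 0 < w.im → w.re ≤ 0 →
      ‖macdonaldIntegral b c w‖ ≤ B) : ‖macdonaldIntegral b c z‖ ≤ B := by
  rcases le_total 0 z.re with h | h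
  · exact h1 h
  · rcases lt_trichotomy z.im 0 with hi | hi | hi
    · have hw : (starRingEnd ℂ) z ∈ Complex.slitPlane := by
        rw [Complex.mem_slitPlane_iff]; right; simpa using hi.ne
      have := h2 _ hw (by simp) (by simpa using hi) (by simpa using h)
      rwa [macdonaldIntegral_conj b c hz, RCLike.norm_conj] at this
    · rcases Complex.mem_slitPlane_iff.1 hz with h3 | h3
      · exact absurd h3 (not_lt.2 h)
      · exact absurd hi h3
    · exact h2 z hz rfl hi h

theorem norm_macdonaldIntegral_le_of_nonpos {b c : ℝ} (hb : -1 < b) {z : ℂ} (hz : z ∈ Complex.slitPlane)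
    (hc : c ≤ 0) {K : ℝ → ℝ}
    (hK : IntegrableOn (fun s : ℝ => s ^ b * Real.exp (-(4 / 5 * s)) * K s) (Ioi 0))
    (hKc : ∀ s : ℝ, 0 < s → (3 / 5 * max 1 (s / (2 * ‖z‖))) ^ c ≤ K s) :
    ‖macdonaldIntegral b c z‖ ≤ ∫ s in Ioi (0 : ℝ), s ^ b * Real.exp (-(4 / 5 * s)) * K s := by
  refine norm_macdonaldIntegral_le_cases hz (fun hre => ?_) fun w hw hn him hre => ?_
  · refine norm_macdonaldIntegral_le_of_re_nonneg hz hre hc (by norm_num) hK fun s hs => ?_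
    refine (Real.rpow_le_rpow_of_nonpos (by positivity) ?_ hc).trans (hKc s hs)
    have : 0 < max 1 (s / (2 * ‖z‖)) := by positivity
    linarith
  · exact norm_macdonaldIntegral_le_of_im_pos hb him hre hc hK (by rwa [hn])

theorem norm_macdonaldIntegral_neg_half_le_exp {z : ℂ} (hz : z ∈ Complex.slitPlane) :
    ‖macdonaldIntegral (-(1 / 2)) (-(1 / 2)) z‖ ≤
      Real.Gamma (1 / 2) * Real.exp (1 / 4 / ‖z‖) := by
  refine norm_macdonaldIntegral_le_cases hz (fun hre => ?_) fun w hw hn him hre => ?_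
  · have hi := rpow_mul_exp_neg_integrable (b := -(1 / 2)) (m := 1) (by norm_num) one_pos
    have h := norm_macdonaldIntegral_le_of_re_nonneg (b := -(1 / 2)) (c := -(1 / 2)) (m := 1)
      (K := fun _ => 1) hz hre (by norm_num) le_rfl (by simpa only [mul_one] using hi) fun s hs =>
      Real.rpow_le_one_of_one_le_of_nonpos (le_max_left _ _) (by norm_num)
    simp only [mul_one] at h
    rw [rpow_mul_exp_neg_integral (by norm_num) one_pos] at h
    norm_num at h
    refine h.trans (le_mul_of_one_le_right ?_ (Real.one_le_exp (by positivity)))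
    exact (Real.Gamma_pos_of_pos (by norm_num)).le
  · rw [← hn]
    exact norm_le_exp_of_im_pos him hre

theorem three_fifths_rpow_le : (3 / 5 : ℝ) ^ (-(1 / 2) : ℝ) ≤ 2 := by
  refine le_of_sq_le_sq ?_ (by norm_num)
  rw [← Real.rpow_natCast, ← Real.rpow_mul (by norm_num)]
  norm_num

theorem max_rpow_le_two {q : ℝ} : (3 / 5 * max 1 q) ^ (-(1 / 2) : ℝ) ≤ 2 := by
  refine (Real.rpow_le_rpow_of_nonpos (by norm_num) ?_ (by norm_num)).trans three_fifths_rpow_le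
  have := le_max_left 1 q
  linarith

theorem max_rpow_le {r s : ℝ} (hr : 0 < r) (hs : 0 < s) :
    (3 / 5 * max 1 (s / (2 * r))) ^ (-(1 / 2) : ℝ) ≤ 4 * r ^ (1 / 2 : ℝ) * s ^ (-(1 / 2) : ℝ) := by
  -- The true factor is `3/10`; `1/16` is smaller and its power `-1/2` is exactly `4`.
  have h : (3 / 5 * max 1 (s / (2 * r))) ^ (-(1 / 2) : ℝ) ≤ (1 / 16 * r⁻¹ * s) ^ (-(1 / 2) : ℝ) := by
    refine Real.rpow_le_rpow_of_nonpos (by positivity) ?_ (by norm_num)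
    have := le_max_right 1 (s / (2 * r))
    have e : s / (2 * r) = 1 / 2 * (r⁻¹ * s) := by field_simp
    have : 0 < r⁻¹ * s := by positivity
    linarith
  refine h.trans_eq ?_
  rw [Real.mul_rpow (by positivity) hs.le, Real.mul_rpow (by norm_num) (by positivity),
    Real.inv_rpow hr.le, Real.rpow_neg hr.le, inv_inv]
  congr 2
  rw [show (1 / 16 : ℝ) = 4 ^ (-2 : ℝ) by rw [Real.rpow_neg (by norm_num)]; norm_num,
    ← Real.rpow_mul (by norm_num)]
  norm_num

theorem norm_macdonaldIntegral_half_le {z : ℂ} (hz : z ∈ Complex.slitPlane) :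
    ‖macdonaldIntegral (1 / 2) (-(1 / 2)) z‖ ≤ 2 * Real.Gamma (1 / 2) := by
  have hi := rpow_mul_exp_neg_integrable (b := 1 / 2) (m := 4 / 5) (by norm_num) (by norm_num)
  refine (norm_macdonaldIntegral_le_of_nonpos (by norm_num) hz (by norm_num) (hi.mul_const 2)
    fun s hs => max_rpow_le_two).trans ?_
  rw [integral_mul_const, rpow_mul_exp_neg_integral (by norm_num) (by norm_num)]
  have h1 := five_fourths_rpow_le
  have hΓ : 0 < Real.Gamma (1 / 2) := Real.Gamma_pos_of_pos (by norm_num)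
  have h3 := gamma_three_halves
  norm_num at h1 h3 hΓ ⊢
  rw [h3]
  nlinarith

/-- The decay `s^{-1/2}` of the base cancels the factor `s^{1/2}`, leaving a convergent integral of
`e^{-4s/5}`. This is why the difference for `μ = 0` has no logarithm at the origin. -/
theorem norm_macdonaldIntegral_half_le_sqrt {z : ℂ} (hz : z ∈ Complex.slitPlane) :
    ‖macdonaldIntegral (1 / 2) (-(1 / 2)) z‖ ≤ 5 * ‖z‖ ^ (1 / 2 : ℝ) := by
  have hr : 0 < ‖z‖ := norm_pos_iff.2 (Complex.slitPlane_ne_zero hz)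
  have hi := rpow_mul_exp_neg_integrable (b := 0) (m := 4 / 5) (by norm_num) (by norm_num)
  have e : ∀ s ∈ Ioi (0 : ℝ), s ^ (0 : ℝ) * Real.exp (-(4 / 5 * s)) * (4 * ‖z‖ ^ (1 / 2 : ℝ)) =
      s ^ (1 / 2 : ℝ) * Real.exp (-(4 / 5 * s)) *
        (4 * ‖z‖ ^ (1 / 2 : ℝ) * s ^ (-(1 / 2) : ℝ)) := by
    intro s hs
    have : s ^ (0 : ℝ) = s ^ (1 / 2 : ℝ) * s ^ (-(1 / 2) : ℝ) := by
      rw [← Real.rpow_add hs]; norm_num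
    rw [this]; ring
  refine (norm_macdonaldIntegral_le_of_nonpos (by norm_num) hz (by norm_num)
    ((integrableOn_congr_fun e measurableSet_Ioi).1 (hi.mul_const _))
    fun s hs => max_rpow_le hr hs).trans ?_
  rw [← setIntegral_congr_fun measurableSet_Ioi e, integral_mul_const,
    rpow_mul_exp_neg_integral (by norm_num) (by norm_num)]
  norm_num
  linarith

/-- The integral is cut at `r = |z|` and at `R`. Below `r` the base is bounded below, giving `√r`.
Between the cuts the integrand is at most `4√r/s`, giving `√r log(R/r)`. Beyond `R` the exponential
makes the rest `O(√r/R)`. -/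
theorem norm_macdonaldIntegral_neg_half_le_log {R : ℝ} (hR : 0 < R) :
    ∃ C, 0 < C ∧ ∀ z ∈ Complex.slitPlane, ‖z‖ ≤ R →
      ‖macdonaldIntegral (-(1 / 2)) (-(1 / 2)) z‖ ≤
        C * ‖z‖ ^ (1 / 2 : ℝ) * (1 + |Real.log ‖z‖|) := by
  refine ⟨8 + 4 * |Real.log R| + 5 / R, by positivity, fun z hz hzR => ?_⟩
  have hr : 0 < ‖z‖ := norm_pos_iff.2 (Complex.slitPlane_ne_zero hz)
  set r := ‖z‖ with hrdef
  set K : ℝ → ℝ := fun s => (3 / 5 * max 1 (s / (2 * r))) ^ (-(1 / 2) : ℝ) with hK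
  set f : ℝ → ℝ := fun s => s ^ (-(1 / 2) : ℝ) * Real.exp (-(4 / 5 * s)) * K s with hf
  have hK0 : ∀ s, 0 ≤ K s := fun s => by simp only [hK]; positivity
  have hi := rpow_mul_exp_neg_integrable (b := -(1 / 2)) (m := 4 / 5) (by norm_num) (by norm_num)
  have hfi : IntegrableOn f (Ioi 0) := by
    refine Integrable.mul_bdd (c := 2) hi ?_ ?_
    · refine Continuous.aestronglyMeasurable ?_
      refine Continuous.rpow_const (by fun_prop) fun s => Or.inl ?_
      have := le_max_left 1 (s / (2 * r))
      positivity
    · refine ae_of_all _ fun s => ?_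
      rw [Real.norm_of_nonneg (hK0 s)]
      exact max_rpow_le_two
  have hmain := norm_macdonaldIntegral_le_of_nonpos (b := -(1 / 2)) (c := -(1 / 2)) (K := K)
    (by norm_num) hz (by norm_num) hfi fun s _ => le_rfl
  have hfi1 : IntegrableOn f (Ioc 0 r) := hfi.mono_set Ioc_subset_Ioi_self
  have hfi2 : IntegrableOn f (Ioc r R) :=
    hfi.mono_set fun s hs => hr.trans hs.1
  have hfi3 : IntegrableOn f (Ioi R) := hfi.mono_set (Ioi_subset_Ioi hR.le)
  have hsplit : ∫ s in Ioi (0 : ℝ), f s =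
      (∫ s in Ioc 0 r, f s) + ((∫ s in Ioc r R, f s) + ∫ s in Ioi R, f s) := by
    rw [← setIntegral_union (Ioc_disjoint_Ioi le_rfl) measurableSet_Ioi hfi2 hfi3,
      Ioc_union_Ioi_eq_Ioi hzR, ← setIntegral_union (Ioc_disjoint_Ioi le_rfl) measurableSet_Ioi hfi1
        (hfi.mono_set (Ioi_subset_Ioi hr.le)), Ioc_union_Ioi_eq_Ioi hr.le]
  have hexp : ∀ s : ℝ, 0 < s → Real.exp (-(4 / 5 * s)) ≤ 1 := fun s hs =>
    Real.exp_le_one_iff.2 (by linarith)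
  have hinv : ∀ s : ℝ, 0 < s → s ^ (-(1 / 2) : ℝ) * s ^ (-(1 / 2) : ℝ) = s⁻¹ := fun s hs => by
    rw [← Real.rpow_add hs, ← Real.rpow_neg_one]; norm_num
  have b1 : ∫ s in Ioc 0 r, f s ≤ 4 * r ^ (1 / 2 : ℝ) := by
    have hint : IntegrableOn (fun s : ℝ => s ^ (-(1 / 2) : ℝ)) (Ioc 0 r) :=
      (intervalIntegrable_iff_integrableOn_Ioc_of_le hr.le).1
        (intervalIntegral.intervalIntegrable_rpow' (by norm_num))
    have h := setIntegral_mono_on hfi1 (hint.mul_const 2) measurableSet_Ioc fun s hs => ?_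
    · refine h.trans_eq ?_
      rw [integral_mul_const, ← intervalIntegral.integral_of_le hr.le,
        integral_rpow (Or.inl (by norm_num))]
      norm_num
      ring
    · have hs0 : 0 < s := hs.1
      calc f s ≤ s ^ (-(1 / 2) : ℝ) * 1 * 2 := by
            simp only [hf]
            have h1 := hexp s hs0
            have h2 : K s ≤ 2 := max_rpow_le_two
            have := hK0 s
            gcongr
        _ = _ := by ring
  have b2 : ∫ s in Ioc r R, f s ≤ 4 * r ^ (1 / 2 : ℝ) * (Real.log R - Real.log r) := by
    have hint : IntegrableOn (fun s : ℝ => s⁻¹) (Ioc r R) :=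
      (intervalIntegrable_iff_integrableOn_Ioc_of_le hzR).1
        (intervalIntegral.intervalIntegrable_inv (fun s hs => by
          rw [uIcc_of_le hzR] at hs; exact (hr.trans_le hs.1).ne') continuousOn_id)
    have h := setIntegral_mono_on hfi2 (hint.const_mul (4 * r ^ (1 / 2 : ℝ))) measurableSet_Ioc
      fun s hs => ?_
    · refine h.trans_eq ?_
      rw [integral_const_mul, ← intervalIntegral.integral_of_le hzR, integral_inv_of_pos hr hR,
        Real.log_div hR.ne' hr.ne']
    · have hs0 : 0 < s := hr.trans hs.1
      calc f s ≤ s ^ (-(1 / 2) : ℝ) * 1 * (4 * r ^ (1 / 2 : ℝ) * s ^ (-(1 / 2) : ℝ)) := by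
            simp only [hf]
            have h1 := hexp s hs0
            have h2 : K s ≤ _ := max_rpow_le hr hs0
            have := hK0 s
            gcongr
        _ = 4 * r ^ (1 / 2 : ℝ) * (s ^ (-(1 / 2) : ℝ) * s ^ (-(1 / 2) : ℝ)) := by ring
        _ = _ := by rw [hinv s hs0]
  have b3 : ∫ s in Ioi R, f s ≤ 4 * r ^ (1 / 2 : ℝ) * R⁻¹ * (5 / 4) := by
    have hi0 := rpow_mul_exp_neg_integrable (b := 0) (m := 4 / 5) (by norm_num) (by norm_num)
    have hi1 := hi0.mono_set (Ioi_subset_Ioi hR.le)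
    have h := setIntegral_mono_on hfi3 (hi1.const_mul (4 * r ^ (1 / 2 : ℝ) * R⁻¹)) measurableSet_Ioi
      fun s hs => ?_
    · refine h.trans ?_
      rw [integral_const_mul]
      have h2 := setIntegral_mono_set hi0 (ae_restrict_of_forall_mem measurableSet_Ioi
        fun s (hs : (0 : ℝ) < s) => by positivity) (Ioi_subset_Ioi hR.le).eventuallyLE
      rw [rpow_mul_exp_neg_integral (b := 0) (by norm_num) (by norm_num)] at h2
      norm_num at h2
      gcongr
      simpa using h2
    · have hs1 : R < s := hs
      have hs0 : 0 < s := hR.trans hs1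
      calc f s ≤ s ^ (-(1 / 2) : ℝ) * Real.exp (-(4 / 5 * s)) *
            (4 * r ^ (1 / 2 : ℝ) * s ^ (-(1 / 2) : ℝ)) := by
            simp only [hf]
            have h2 : K s ≤ _ := max_rpow_le hr hs0
            gcongr
        _ = 4 * r ^ (1 / 2 : ℝ) * (s ^ (-(1 / 2) : ℝ) * s ^ (-(1 / 2) : ℝ)) *
            Real.exp (-(4 / 5 * s)) := by ring
        _ = 4 * r ^ (1 / 2 : ℝ) * s⁻¹ * Real.exp (-(4 / 5 * s)) := by rw [hinv s hs0]
        _ ≤ 4 * r ^ (1 / 2 : ℝ) * R⁻¹ * Real.exp (-(4 / 5 * s)) := by gcongr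
        _ = _ := by rw [Real.rpow_zero, one_mul]
  refine hmain.trans ?_
  have hq : 0 < r ^ (1 / 2 : ℝ) := by positivity
  have l1 := le_abs_self (Real.log R)
  have l2 := neg_abs_le (Real.log r)
  have l3 := abs_nonneg (Real.log r)
  have l4 := abs_nonneg (Real.log R)
  have hRi : 0 < R⁻¹ := by positivity
  calc ∫ s in Ioi (0 : ℝ), f s
      ≤ r ^ (1 / 2 : ℝ) * (4 + 4 * (Real.log R - Real.log r) + 5 * R⁻¹) := by
        rw [hsplit]; linarith
    _ ≤ r ^ (1 / 2 : ℝ) * ((8 + 4 * |Real.log R| + 5 / R) * (1 + |Real.log r|)) := by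
        gcongr
        rw [div_eq_mul_inv]
        nlinarith [mul_nonneg l4 l3, mul_nonneg hRi.le l3]
    _ = _ := by ring

/-- Pointwise, `1 + t/(2r) ≤ (R/r)(1 + t/(2R))` when `r ≤ R`, which produces the power `r^{-c}` at
once. -/
theorem macdonaldRealIntegral_le_scale {b c : ℝ} (hb : -1 < b) (hc : 0 ≤ c) {r R : ℝ} (hr : 0 < r)
    (hrR : r ≤ R) :
    macdonaldRealIntegral b c r ≤ R ^ c * macdonaldRealIntegral b c R * r ^ (-c) := by
  have hR : 0 < R := hr.trans_le hrR
  have h := setIntegral_mono_on (macdonaldRealIntegrand_integrable hb c hr)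
    ((macdonaldRealIntegrand_integrable hb c hR).const_mul ((R / r) ^ c)) measurableSet_Ioi
    fun t ht => ?_
  · refine h.trans_eq ?_
    rw [integral_const_mul, ← macdonaldRealIntegral, Real.div_rpow hR.le hr.le, Real.rpow_neg hr.le]
    ring
  · have ht' : (0 : ℝ) < t := ht
    have h1 : 1 + t / (2 * r) ≤ R / r * (1 + t / (2 * R)) := by
      have e : R / r * (1 + t / (2 * R)) = R / r + t / (2 * r) := by field_simp
      have : 1 ≤ R / r := (one_le_div hr).2 hrR
      rw [e]; linarith
    calc _ ≤ Real.exp (-t) * t ^ b * (R / r * (1 + t / (2 * R))) ^ c := by gcongr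
      _ = _ := by rw [Real.mul_rpow (by positivity) (by positivity)]; ring

/-! ### Bounds for `macdonaldK` and for differences of consecutive orders -/

/-- Half-integrality enters only through this dichotomy: the inner exponent `μ - 1/2` is either
`-1/2` or nonnegative. -/
theorem eq_zero_or_half_le {μ : ℝ} (hμ : ∃ n : ℕ, μ = (n : ℝ) / 2) : μ = 0 ∨ 1 / 2 ≤ μ := by
  obtain ⟨n, rfl⟩ := hμ
  rcases Nat.eq_zero_or_pos n with rfl | hn
  · left; simp
  · right
    have : (1 : ℝ) ≤ n := by exact_mod_cast hn
    linarith

theorem norm_exp_mul_macdonaldK_le {μ : ℝ} (hμ : μ = 0 ∨ 1 / 2 ≤ μ) {z : ℂ}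
    (hz : z ∈ Complex.slitPlane) :
    ‖Complex.exp z * macdonaldK μ z‖ ≤
      Real.sqrt (Real.pi / (2 * ‖z‖)) * Real.exp (|μ ^ 2 - 1 / 4| / ‖z‖) := by
  have hr : 0 < ‖z‖ := norm_pos_iff.2 (Complex.slitPlane_ne_zero hz)
  have hμ' : -(1 / 2) < μ := by rcases hμ with h | h <;> linarith
  have hΓ : 0 < Real.Gamma (μ + 1 / 2) := Real.Gamma_pos_of_pos (by linarith)
  rw [norm_exp_mul_macdonaldK hμ' hz, sqrt_pi_div_two_mul hr]
  gcongr
  rw [div_le_iff₀' hΓ]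
  rcases hμ with rfl | h
  · have := norm_macdonaldIntegral_neg_half_le_exp hz
    have e : |(0 : ℝ) ^ 2 - 1 / 4| = 1 / 4 := by norm_num [abs_of_pos]
    rw [e, zero_sub, zero_add]
    exact this
  · have h1 := (norm_macdonaldIntegral_le (b := μ - 1 / 2) (c := μ - 1 / 2) (by linarith)
      (by linarith) hz).trans (macdonaldRealIntegral_le_exp (by linarith) hr)
    rw [show μ - 1 / 2 + 1 = μ + 1 / 2 by ring] at h1
    refine h1.trans ?_
    gcongr ?_ * Real.exp ?_
    have h2 : (μ - 1 / 2) * (μ + 1 / 2) = μ ^ 2 - 1 / 4 := by ring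
    have h3 : 0 ≤ μ ^ 2 - 1 / 4 := by nlinarith
    rw [h2, abs_of_nonneg h3]
    gcongr
    linarith

/-- For `μ ≥ 1/2`, raising the inner exponent from `μ - 1/2` to `μ + 1/2` only increases the real
integral, and the exponential bound with `b = μ + 1/2` applies. For `μ = 0` the integral is bounded
outright. -/
theorem norm_macdonaldIntegral_diff_le {μ : ℝ} (hμ : μ = 0 ∨ 1 / 2 ≤ μ) {z : ℂ}
    (hz : z ∈ Complex.slitPlane) :
    ‖macdonaldIntegral (μ + 1 / 2) (μ - 1 / 2) z‖ / Real.Gamma (μ + 1 / 2) ≤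
      2 * (μ + 1) ^ 2 * Real.exp ((μ + 1) ^ 2 / ‖z‖) := by
  have hr : 0 < ‖z‖ := norm_pos_iff.2 (Complex.slitPlane_ne_zero hz)
  have hΓ : 0 < Real.Gamma (μ + 1 / 2) :=
    Real.Gamma_pos_of_pos (by rcases hμ with h | h <;> linarith)
  rw [div_le_iff₀ hΓ]
  rcases hμ with rfl | h
  · have h1 := norm_macdonaldIntegral_half_le hz
    have h2 : 1 ≤ Real.exp ((0 + 1) ^ 2 / ‖z‖) := Real.one_le_exp (by positivity)
    rw [zero_add] at hΓ
    rw [zero_add, zero_sub]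
    refine h1.trans ?_
    rw [zero_add] at h2 ⊢
    nlinarith
  · have h1 := norm_macdonaldIntegral_le (b := μ + 1 / 2) (c := μ - 1 / 2) (by linarith)
      (by linarith) hz
    have h2 := macdonaldRealIntegral_split (b := μ + 1 / 2) (by linarith) (μ + 1 / 2) hr
    rw [show μ + 1 / 2 - 1 = μ - 1 / 2 by ring] at h2
    have h3 := macdonaldRealIntegral_nonneg (μ + 1 / 2 + 1) (μ - 1 / 2) hr
    have h4 := macdonaldRealIntegral_le_exp (b := μ + 1 / 2) (by linarith) hr
    have h5 : 0 ≤ 1 / (2 * ‖z‖) * macdonaldRealIntegral (μ + 1 / 2 + 1) (μ - 1 / 2) ‖z‖ := by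
      positivity
    rw [Real.Gamma_add_one (by linarith)] at h4
    have h6 : (μ + 1 / 2) * (μ + 1 / 2 + 1) / (2 * ‖z‖) ≤ (μ + 1) ^ 2 / ‖z‖ := by
      rw [div_le_div_iff₀ (by positivity) hr]
      nlinarith [mul_pos hr hr, sq_nonneg μ]
    calc ‖macdonaldIntegral (μ + 1 / 2) (μ - 1 / 2) z‖
        ≤ (μ + 1 / 2) * Real.Gamma (μ + 1 / 2) *
          Real.exp ((μ + 1 / 2) * (μ + 1 / 2 + 1) / (2 * ‖z‖)) := by linarith
      _ ≤ (2 * (μ + 1) ^ 2) * Real.Gamma (μ + 1 / 2) * Real.exp ((μ + 1) ^ 2 / ‖z‖) := by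
          gcongr
          nlinarith
      _ = _ := by ring

theorem norm_exp_mul_macdonaldK_sub_le {μ : ℝ} (hμ : μ = 0 ∨ 1 / 2 ≤ μ) {z : ℂ}
    (hz : z ∈ Complex.slitPlane) :
    ‖Complex.exp z * (macdonaldK μ z - macdonaldK (μ + 1) z)‖ ≤
      (Real.sqrt (8 * Real.pi ^ 3) * (μ + 1) ^ 2) / ‖z‖ ^ (3 / 2 : ℝ) *
        Real.exp ((Real.sqrt (8 * Real.pi ^ 3) * (μ + 1) ^ 2) / ‖z‖) := by
  have hr : 0 < ‖z‖ := norm_pos_iff.2 (Complex.slitPlane_ne_zero hz)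
  have hμ' : -(1 / 2) < μ := by rcases hμ with h | h <;> linarith
  have hpi := Real.pi_gt_three
  have s1 : 1 ≤ Real.sqrt (8 * Real.pi ^ 3) := by
    rw [Real.one_le_sqrt]
    have : (3 : ℝ) ^ 3 ≤ Real.pi ^ 3 := by gcongr
    linarith
  have s2 : Real.sqrt (Real.pi / 2) * 2 ≤ Real.sqrt (8 * Real.pi ^ 3) := by
    -- After squaring this is `2π ≤ 8π³`; the stated constant is far from tight.
    refine Real.le_sqrt_of_sq_le ?_
    rw [mul_pow, Real.sq_sqrt (by positivity)]
    nlinarith [mul_pos (mul_pos Real.pi_pos Real.pi_pos) Real.pi_pos,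
      mul_pos Real.pi_pos (mul_pos Real.pi_pos (sub_pos.2 hpi)),
      mul_pos Real.pi_pos (sub_pos.2 hpi)]
  rw [norm_exp_mul_macdonaldK_sub hμ' hz]
  calc _ ≤ Real.sqrt (Real.pi / 2) * ‖z‖ ^ (-(3 / 2) : ℝ) *
        (2 * (μ + 1) ^ 2 * Real.exp ((μ + 1) ^ 2 / ‖z‖)) := by
        gcongr
        exact norm_macdonaldIntegral_diff_le hμ hz
    _ = (Real.sqrt (Real.pi / 2) * 2) * (μ + 1) ^ 2 / ‖z‖ ^ (3 / 2 : ℝ) *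
        Real.exp ((μ + 1) ^ 2 / ‖z‖) := by
        rw [Real.rpow_neg hr.le]; ring
    _ ≤ _ := by
        gcongr
        exact le_mul_of_one_le_left (by positivity) s1

theorem norm_exp_mul_macdonaldK_le_local {μ : ℝ} (hμ : μ = 0 ∨ 1 / 2 ≤ μ) {R : ℝ} (hR : 0 < R) :
    ∃ C : ℝ, 0 < C ∧ ∀ z ∈ Complex.slitPlane, ‖z‖ ≤ R →
      ‖Complex.exp z * macdonaldK μ z‖ ≤
        C * (if μ = 0 then 1 + |Real.log ‖z‖| else ‖z‖ ^ (-μ)) := by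
  have hμ' : -(1 / 2) < μ := by rcases hμ with h | h <;> linarith
  have hΓ : 0 < Real.Gamma (μ + 1 / 2) := Real.Gamma_pos_of_pos (by linarith)
  have hpi : 0 < Real.sqrt (Real.pi / 2) := Real.sqrt_pos.2 (by positivity)
  rcases hμ with rfl | h
  · obtain ⟨C, hC, H⟩ := norm_macdonaldIntegral_neg_half_le_log hR
    refine ⟨Real.sqrt (Real.pi / 2) * C / Real.Gamma (0 + 1 / 2), by positivity,
      fun z hz hzR => ?_⟩
    have hr : 0 < ‖z‖ := norm_pos_iff.2 (Complex.slitPlane_ne_zero hz)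
    have h1 := H z hz hzR
    rw [norm_exp_mul_macdonaldK hμ' hz, if_pos rfl, zero_sub]
    have e : ‖z‖ ^ (-(1 / 2) : ℝ) * ‖z‖ ^ (1 / 2 : ℝ) = 1 := by rw [← Real.rpow_add hr]; norm_num
    calc _ ≤ Real.sqrt (Real.pi / 2) * ‖z‖ ^ (-(1 / 2) : ℝ) *
          (C * ‖z‖ ^ (1 / 2 : ℝ) * (1 + |Real.log ‖z‖|) / Real.Gamma (0 + 1 / 2)) := by gcongr
      _ = Real.sqrt (Real.pi / 2) * C / Real.Gamma (0 + 1 / 2) * (1 + |Real.log ‖z‖|) *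
          (‖z‖ ^ (-(1 / 2) : ℝ) * ‖z‖ ^ (1 / 2 : ℝ)) := by ring
      _ = _ := by rw [e, mul_one]
  · set X := R ^ (μ - 1 / 2) * macdonaldRealIntegral (μ - 1 / 2) (μ - 1 / 2) R with hX
    have hX0 : 0 ≤ X := mul_nonneg (by positivity) (macdonaldRealIntegral_nonneg _ _ hR)
    -- `X + 1` replaces `X` because only `0 ≤ X` is at hand and the constant must be positive.
    refine ⟨Real.sqrt (Real.pi / 2) * (X + 1) / Real.Gamma (μ + 1 / 2), by positivity,
      fun z hz hzR => ?_⟩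
    have hr : 0 < ‖z‖ := norm_pos_iff.2 (Complex.slitPlane_ne_zero hz)
    have h1 := (norm_macdonaldIntegral_le (b := μ - 1 / 2) (c := μ - 1 / 2) (by linarith)
      (by linarith) hz).trans (macdonaldRealIntegral_le_scale (by linarith) (by linarith) hr hzR)
    rw [← hX] at h1
    rw [norm_exp_mul_macdonaldK hμ' hz, if_neg (by linarith)]
    have e : ‖z‖ ^ (-(1 / 2) : ℝ) * ‖z‖ ^ (-(μ - 1 / 2) : ℝ) = ‖z‖ ^ (-μ) := by
      rw [← Real.rpow_add hr]; ring_nf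
    calc _ ≤ Real.sqrt (Real.pi / 2) * ‖z‖ ^ (-(1 / 2) : ℝ) *
          ((X + 1) * ‖z‖ ^ (-(μ - 1 / 2) : ℝ) / Real.Gamma (μ + 1 / 2)) := by
          gcongr
          refine h1.trans ?_
          gcongr
          linarith
      _ = Real.sqrt (Real.pi / 2) * (X + 1) / Real.Gamma (μ + 1 / 2) *
          (‖z‖ ^ (-(1 / 2) : ℝ) * ‖z‖ ^ (-(μ - 1 / 2) : ℝ)) := by ring
      _ = _ := by rw [e]

theorem norm_exp_mul_macdonaldK_sub_le_local {μ : ℝ} (hμ : μ = 0 ∨ 1 / 2 ≤ μ) :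
    ∃ C : ℝ, 0 < C ∧ ∀ z ∈ Complex.slitPlane, ‖z‖ ≤ 1 →
      ‖Complex.exp z * (macdonaldK μ z - macdonaldK (μ + 1) z)‖ ≤ C * (‖z‖ ^ (-μ) / ‖z‖) := by
  have hμ' : -(1 / 2) < μ := by rcases hμ with h | h <;> linarith
  have hΓ : 0 < Real.Gamma (μ + 1 / 2) := Real.Gamma_pos_of_pos (by linarith)
  have hpi : 0 < Real.sqrt (Real.pi / 2) := Real.sqrt_pos.2 (by positivity)
  suffices h : ∃ D : ℝ, 0 < D ∧ ∀ z ∈ Complex.slitPlane, ‖z‖ ≤ 1 →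
      ‖macdonaldIntegral (μ + 1 / 2) (μ - 1 / 2) z‖ ≤ D * ‖z‖ ^ (-(μ - 1 / 2)) by
    obtain ⟨D, hD, H⟩ := h
    refine ⟨Real.sqrt (Real.pi / 2) * D / Real.Gamma (μ + 1 / 2), by positivity,
      fun z hz hz1 => ?_⟩
    have hr : 0 < ‖z‖ := norm_pos_iff.2 (Complex.slitPlane_ne_zero hz)
    have h1 := H z hz hz1
    rw [norm_exp_mul_macdonaldK_sub hμ' hz]
    have e : ‖z‖ ^ (-(3 / 2) : ℝ) * ‖z‖ ^ (-(μ - 1 / 2) : ℝ) = ‖z‖ ^ (-μ) / ‖z‖ := by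
      rw [← Real.rpow_add hr, ← Real.rpow_sub_one hr.ne']; ring_nf
    calc _ ≤ Real.sqrt (Real.pi / 2) * ‖z‖ ^ (-(3 / 2) : ℝ) *
          (D * ‖z‖ ^ (-(μ - 1 / 2) : ℝ) / Real.Gamma (μ + 1 / 2)) := by gcongr
      _ = Real.sqrt (Real.pi / 2) * D / Real.Gamma (μ + 1 / 2) *
          (‖z‖ ^ (-(3 / 2) : ℝ) * ‖z‖ ^ (-(μ - 1 / 2) : ℝ)) := by ring
      _ = _ := by rw [e]
  rcases hμ with rfl | h
  · refine ⟨5, by norm_num, fun z hz _ => ?_⟩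
    have := norm_macdonaldIntegral_half_le_sqrt hz
    rwa [zero_add, zero_sub, neg_neg]
  · have hX0 := macdonaldRealIntegral_nonneg (μ + 1 / 2) (μ - 1 / 2) one_pos
    refine ⟨macdonaldRealIntegral (μ + 1 / 2) (μ - 1 / 2) 1 + 1, by positivity,
      fun z hz hz1 => ?_⟩
    have hr : 0 < ‖z‖ := norm_pos_iff.2 (Complex.slitPlane_ne_zero hz)
    have h1 := (norm_macdonaldIntegral_le (b := μ + 1 / 2) (c := μ - 1 / 2) (by linarith)
      (by linarith) hz).trans (macdonaldRealIntegral_le_scale (by linarith) (by linarith) hr hz1)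
    rw [Real.one_rpow, one_mul] at h1
    refine h1.trans ?_
    gcongr
    linarith

theorem norm_exp_mul_macdonaldK_le_majorantM {μ : ℝ} (hμ : μ = 0 ∨ 1 / 2 ≤ μ) :
    ∃ C : ℝ, 0 < C ∧ ∀ z ∈ Complex.slitPlane,
      ‖Complex.exp z * macdonaldK μ z‖ ≤ C * majorantM μ ‖z‖ := by
  obtain ⟨C, hC, H⟩ := norm_exp_mul_macdonaldK_le_local hμ one_pos
  set D := Real.sqrt (Real.pi / 2) * Real.exp |μ ^ 2 - 1 / 4| with hD
  have hD0 : 0 ≤ D := by positivity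
  refine ⟨C + D, by positivity, fun z hz => ?_⟩
  have hr : 0 < ‖z‖ := norm_pos_iff.2 (Complex.slitPlane_ne_zero hz)
  rw [majorantM]
  split_ifs with h1 h2
  · refine (norm_exp_mul_macdonaldK_le hμ hz).trans ?_
    rw [sqrt_pi_div_two_mul hr]
    calc _ ≤ Real.sqrt (Real.pi / 2) * ‖z‖ ^ (-(1 / 2) : ℝ) * Real.exp |μ ^ 2 - 1 / 4| := by
          gcongr
          exact div_le_self (abs_nonneg _) h1
      _ = D * ‖z‖ ^ (-(1 / 2) : ℝ) := by rw [hD]; ring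
      _ ≤ _ := by gcongr; linarith
  · have h3 := H z hz (le_of_not_ge h1)
    rw [if_pos h2] at h3
    refine h3.trans ?_
    gcongr
    linarith
  · have h3 := H z hz (le_of_not_ge h1)
    rw [if_neg h2] at h3
    refine h3.trans ?_
    gcongr
    linarith

theorem norm_exp_mul_macdonaldK_sub_le_majorantN {μ : ℝ} (hμ : μ = 0 ∨ 1 / 2 ≤ μ) :
    ∃ C : ℝ, 0 < C ∧ ∀ z ∈ Complex.slitPlane,
      ‖Complex.exp z * (macdonaldK μ z - macdonaldK (μ + 1) z)‖ ≤
        C * (majorantN μ ‖z‖ / ‖z‖) := by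
  obtain ⟨C, hC, H⟩ := norm_exp_mul_macdonaldK_sub_le_local hμ
  set A := Real.sqrt (8 * Real.pi ^ 3) * (μ + 1) ^ 2 with hA
  have hA0 : 0 ≤ A := by positivity
  refine ⟨C + A * Real.exp A, by positivity, fun z hz => ?_⟩
  have hr : 0 < ‖z‖ := norm_pos_iff.2 (Complex.slitPlane_ne_zero hz)
  rw [majorantN]
  split_ifs with h1
  · have e : ‖z‖ ^ (-(1 / 2) : ℝ) / ‖z‖ = (‖z‖ ^ (3 / 2 : ℝ))⁻¹ := by
      rw [← Real.rpow_sub_one hr.ne', ← Real.rpow_neg hr.le]; norm_num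
    rw [e]
    calc _ ≤ A / ‖z‖ ^ (3 / 2 : ℝ) * Real.exp (A / ‖z‖) := norm_exp_mul_macdonaldK_sub_le hμ hz
      _ ≤ A / ‖z‖ ^ (3 / 2 : ℝ) * Real.exp A := by
          gcongr
          exact div_le_self hA0 h1
      _ = A * Real.exp A * (‖z‖ ^ (3 / 2 : ℝ))⁻¹ := by ring
      _ ≤ _ := by gcongr; linarith
  · refine (H z hz (le_of_not_ge h1)).trans ?_
    gcongr
    have : 0 ≤ A * Real.exp A := by positivity
    linarith

/-! ### Monotonicity and comparison of the majorants -/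

theorem strictAntiOn_majorantM {μ : ℝ} (hμ : 0 ≤ μ) : StrictAntiOn (majorantM μ) (Ioi 0) := by
  intro x hx y hy hxy
  have hx0 : (0 : ℝ) < x := hx
  have hlow : ∀ t : ℝ, 1 < t → t ^ (-(1 / 2) : ℝ) < 1 := fun t ht =>
    Real.rpow_lt_one_of_one_lt_of_neg ht (by norm_num)
  have hle : ∀ t : ℝ, 1 ≤ t → t ^ (-(1 / 2) : ℝ) ≤ 1 := fun t ht =>
    Real.rpow_le_one_of_one_le_of_nonpos ht (by norm_num)
  rcases le_or_gt 1 x with h1 | h1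
  · simp only [majorantM, if_pos h1, if_pos (h1.trans hxy.le)]
    exact Real.rpow_lt_rpow_of_neg hx0 hxy (by norm_num)
  · have hlogx := Real.log_neg hx0 h1
    rcases le_or_gt 1 y with h2 | h2
    · simp only [majorantM, if_neg (not_le.2 h1), if_pos h2]
      refine (hle y h2).trans_lt ?_
      split_ifs with h3
      · have := abs_pos.2 hlogx.ne
        linarith
      · exact Real.one_lt_rpow_of_pos_of_lt_one_of_neg hx0 h1
          (neg_lt_zero.2 (lt_of_le_of_ne hμ (Ne.symm h3)))
    · simp only [majorantM, if_neg (not_le.2 h1), if_neg (not_le.2 h2)]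
      split_ifs with h3
      · rw [abs_of_neg hlogx, abs_of_neg (Real.log_neg (hx0.trans hxy) h2)]
        have := Real.log_lt_log hx0 hxy
        linarith
      · exact Real.rpow_lt_rpow_of_neg hx0 hxy (neg_lt_zero.2 (lt_of_le_of_ne hμ (Ne.symm h3)))

theorem majorantN_eq_majorantM {μ : ℝ} (hμ : μ ≠ 0) : majorantN μ = majorantM μ := by
  ext r
  simp [majorantN, majorantM, hμ]

theorem antitoneOn_majorantN {μ : ℝ} (hμ : 0 ≤ μ) : AntitoneOn (majorantN μ) (Ioi 0) := by
  rcases eq_or_ne μ 0 with rfl | h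
  · intro x hx y hy hxy
    have hx0 : (0 : ℝ) < x := hx
    have hle : ∀ t : ℝ, 1 ≤ t → t ^ (-(1 / 2) : ℝ) ≤ 1 := fun t ht =>
      Real.rpow_le_one_of_one_le_of_nonpos ht (by norm_num)
    simp only [majorantN, neg_zero, Real.rpow_zero]
    split_ifs with h1 h2 h2
    · exact Real.rpow_le_rpow_of_nonpos hx0 hxy (by norm_num)
    · exact hle y h1
    · exact absurd (h2.trans hxy) h1
    · exact le_rfl
  · rw [majorantN_eq_majorantM h]
    exact (strictAntiOn_majorantM hμ).antitoneOn

theorem majorantN_le_majorantM (μ r : ℝ) : majorantN μ r ≤ majorantM μ r := by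
  rcases eq_or_ne μ 0 with rfl | h
  · simp only [majorantN, majorantM, if_true, neg_zero, Real.rpow_zero]
    split_ifs
    · exact le_rfl
    · linarith [abs_nonneg (Real.log r)]
  · rw [majorantN_eq_majorantM h]

theorem mainTheorem2 (μ : ℝ) (hμ : ∃ n : ℕ, μ = (n : ℝ) / 2) :
    -- (a)
    (∀ z ∈ Complex.slitPlane,
      ‖Complex.exp z * macdonaldK μ z‖ ≤
        Real.sqrt (Real.pi / (2 * ‖z‖)) * Real.exp (|μ ^ 2 - 1 / 4| / ‖z‖)) ∧
    -- (b)
    (∀ z ∈ Complex.slitPlane,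
      ‖Complex.exp z * (macdonaldK μ z - macdonaldK (μ + 1) z)‖ ≤
        (Real.sqrt (8 * Real.pi ^ 3) * (μ + 1) ^ 2) / ‖z‖ ^ (3 / 2 : ℝ) *
          Real.exp ((Real.sqrt (8 * Real.pi ^ 3) * (μ + 1) ^ 2) / ‖z‖)) ∧
    -- (c)
    (∀ R : ℝ, 0 < R → ∃ C : ℝ, 0 < C ∧ ∀ z ∈ Complex.slitPlane, ‖z‖ ≤ R →
      ‖Complex.exp z * macdonaldK μ z‖ ≤
        C * (if μ = 0 then 1 + |Real.log ‖z‖| else (‖z‖ / 2) ^ (-μ))) ∧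
    -- global majorants
    (∃ C : ℝ, 0 < C ∧ ∀ z ∈ Complex.slitPlane,
      ‖Complex.exp z * macdonaldK μ z‖ ≤ C * majorantM μ ‖z‖) ∧
    (∃ C : ℝ, 0 < C ∧ ∀ z ∈ Complex.slitPlane,
      ‖Complex.exp z * (macdonaldK μ z - macdonaldK (μ + 1) z)‖ ≤
        C * (majorantN μ ‖z‖ / ‖z‖)) ∧
    -- monotonicity and comparison of the majorants
    StrictAntiOn (majorantM μ) (Ioi 0) ∧
    AntitoneOn (majorantN μ) (Ioi 0) ∧
    StrictAntiOn (majorantN μ) (Ici 1) ∧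
    (μ ≠ 0 → StrictAntiOn (majorantN μ) (Ioi 0)) ∧
    (∀ r : ℝ, 0 < r → majorantN μ r ≤ majorantM μ r) := by
  have h := eq_zero_or_half_le hμ
  have hμ0 : 0 ≤ μ := by rcases h with h | h <;> linarith
  refine ⟨fun z hz => norm_exp_mul_macdonaldK_le h hz,
    fun z hz => norm_exp_mul_macdonaldK_sub_le h hz, fun R hR => ?_,
    norm_exp_mul_macdonaldK_le_majorantM h, norm_exp_mul_macdonaldK_sub_le_majorantN h,
    strictAntiOn_majorantM hμ0, antitoneOn_majorantN hμ0, fun x hx y _ hxy => ?_, fun hne => ?_,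
    fun r _ => majorantN_le_majorantM μ r⟩
  · obtain ⟨C, hC, H⟩ := norm_exp_mul_macdonaldK_le_local h hR
    refine ⟨C, hC, fun z hz hzR => (H z hz hzR).trans ?_⟩
    have hr : 0 < ‖z‖ := norm_pos_iff.2 (Complex.slitPlane_ne_zero hz)
    gcongr ?_ * ?_
    split_ifs
    · exact le_rfl
    -- The local bound with `|z|^{-μ}` is the stronger one, as halving the base increases a
    -- nonpositive power.
    · exact Real.rpow_le_rpow_of_nonpos (by positivity) (by linarith) (by linarith)
  · have hx1 : (1 : ℝ) ≤ x := hx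
    simp only [majorantN, if_pos hx1, if_pos (hx1.trans hxy.le)]
    exact Real.rpow_lt_rpow_of_neg (by linarith) hxy (by norm_num)
  · rw [majorantN_eq_majorantM hne]
    exact strictAntiOn_majorantM hμ0
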